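/- **Proposition 4.9.** A *hypergraph* is a pair $\mathcal{H}=(V,E)$, where $V$ is a finite set of vertices and $E$ is a set of subsets of $V$ (the edges), none properly contained in another. For $v\in V$ the card $\mathcal{H}-v$ has vertex set $V\setminus\{v\}$, and its edges are the edges of $\mathcal{H}$ that do not contain $v$. The *deck* of $\mathcal{H}$ is the collection (with multiplicity) of its cards $\mathcal{H}-v$, $v\in V$, up to isomorphism. An invariant $f$ is *reconstructible* for $\mathcal{H}$ if $f(\mathcal{H})$ is determined by the deck of $\mathcal{H}$, i.e. $f(\mathcal{H}')=f(\mathcal{H})$ for every hypergraph $\mathcal{H}'$ with the same deck as $\mathcal{H}$. Fix a field $\mathbb{K}$. For a hypergraph $\mathcal{H}=(V,E)$ let $A=\mathbb{K}[x_v : v\in V]$, and let $I_{\mathcal{H}}\subset A$ be the edge ideal, generated by the squarefree monomials $\prod_{v\in\varepsilon}x_v$, $\varepsilon\in E$. Let $b_{ij}(I_{\mathcal{H}})$ be its graded Betti numbers, i.e. the number of generators of total degree $j$ in the $i$-th module of the multigraded minimal free resolution of the $A$-module $I_{\mathcal{H}}$. The depth of $I_{\mathcal{H}}$ is the supremum of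 the lengths of $I_{\mathcal{H}}$-regular sequences in the ideal $(x_v : v\in V)$, and its Castelnuovo–Mumford regularity is $\sup\{j-i : b_{ij}(I_{\mathcal{H}})\neq 0\}$. Let $\mathcal{H}$ be a hypergraph on $n\ge 3$ vertices. If the top-degree graded Betti numbers $b_{in}(I_{\mathcal{H}})$, $i\ge 0$, are all reconstructible for $\mathcal{H}$, then the depth, the projective dimension and the Castelnuovo–Mumford regularity of the $A$-module $I_{\mathcal{H}}$ are reconstructible for $\mathcal{H}$. -/

import Mathlib

universe u v

/-! ### Hypergraphs, vertex-deleted subhypergraphs and reconstruction -/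

/-- A hypergraph with vertex set `V`: a set of subsets of `V`, called edges, none of which is
properly contained in another one. -/
structure SpernerHypergraph (V : Type u) where
  /-- The edges. -/
  edges : Set (Finset V)
  /-- An edge contained in an edge is equal to it. -/
  eq_of_subset : ∀ ⦃e₁ e₂ : Finset V⦄, e₁ ∈ edges → e₂ ∈ edges → e₁ ⊆ e₂ → e₁ = e₂

namespace SpernerHypergraph

/-- The card `H - v`: the subhypergraph induced on the vertices different from `v`. Its edges are
the edges of `H` that do not contain `v`. -/
def delete {V : Type u} (H : SpernerHypergraph V) (v : V) : SpernerHypergraph {w : V // w ≠ v} where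
  edges := {e | e.map (Function.Embedding.subtype _) ∈ H.edges}
  eq_of_subset := fun _ _ h₁ h₂ h =>
    Finset.map_injective _ (H.eq_of_subset h₁ h₂ (Finset.map_subset_map.2 h))

/-- Two hypergraphs are isomorphic if some bijection of the vertex sets identifies their edges. -/
def Isomorphic {V W : Type u} (H : SpernerHypergraph V) (H' : SpernerHypergraph W) : Prop :=
  ∃ φ : V ≃ W, ∀ e : Finset V, e.map φ.toEmbedding ∈ H'.edges ↔ e ∈ H.edges

/-- `H` and `H'` have the same deck: their cards (vertex-deleted subhypergraphs), as collections
with multiplicity of hypergraphs up to isomorphism, agree. -/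
def SameDeck {V W : Type u} (H : SpernerHypergraph V) (H' : SpernerHypergraph W) : Prop :=
  ∃ φ : V ≃ W, ∀ v : V, (H.delete v).Isomorphic (H'.delete (φ v))

/-- The invariant `f` of hypergraphs is reconstructible for `H`: its value at `H` is determined by
the deck of `H`, that is, `f` takes the same value on every hypergraph with the same deck. -/
def Reconstructible {α : Type*} (f : ∀ ⦃W : Type u⦄, SpernerHypergraph W → α)
    {V : Type u} (H : SpernerHypergraph V) : Prop :=
  ∀ ⦃W : Type u⦄ (H' : SpernerHypergraph W), H.SameDeck H' → f H' = f H

/-- The edge ideal of `H` in the polynomial ring over `K` with one variable for each vertex: it is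
generated by the squarefree monomials `∏ v ∈ e, x_v` for the edges `e`. -/
noncomputable def edgeIdeal (K : Type v) [Field K] {V : Type u} (H : SpernerHypergraph V) :
    Ideal (MvPolynomial V K) :=
  Ideal.span ((fun e : Finset V => ∏ v ∈ e, MvPolynomial.X v) '' H.edges)

end SpernerHypergraph

/-! ### Homological invariants of an ideal of a polynomial ring -/

/-- A multigraded minimal free resolution
`⋯ → F 2 → F 1 → F 0 → I → 0` of the ideal `I` of `A = K[x_s : s ∈ σ]`, where `F i` is the direct
sum of the modules `A(-degree i k)` over `k < rank i`. (As `I` lies in `A`, all generators of a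
minimal resolution have degrees with nonnegative coordinates.) -/
structure MinimalMultigradedResolution {σ : Type u} {K : Type v} [Field K]
    (I : Ideal (MvPolynomial σ K)) where
  /-- The rank of `F i`. -/
  rank : ℕ → ℕ
  /-- The multidegree of the `k`-th basis vector of `F i`. -/
  degree : ∀ i, Fin (rank i) → (σ →₀ ℕ)
  /-- The augmentation `F 0 → I`, as a map to `A`. -/
  aug : (Fin (rank 0) → MvPolynomial σ K) →ₗ[MvPolynomial σ K] MvPolynomial σ K
  /-- The differentials `F (i + 1) → F i`. -/
  diff : ∀ i, (Fin (rank (i + 1)) → MvPolynomial σ K) →ₗ[MvPolynomial σ K]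
    (Fin (rank i) → MvPolynomial σ K)
  /-- The augmentation maps `F 0` onto `I`. -/
  range_aug : LinearMap.range aug = I
  /-- Exactness at `F 0`. -/
  exact_aug : Function.Exact (diff 0) aug
  /-- Exactness at `F (i + 1)`. -/
  exact_diff : ∀ i, Function.Exact (diff (i + 1)) (diff i)
  /-- The augmentation preserves multidegrees. -/
  aug_homogeneous : ∀ k, ∀ m ∈ (aug (Pi.single k 1)).support, m = degree 0 k
  /-- The differentials preserve multidegrees: a term `x ^ m` times the `l`-th basis vector of
  `F i` has multidegree `m + degree i l`. -/
  diff_homogeneous : ∀ i k l, ∀ m ∈ (diff i (Pi.single k 1) l).support,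
    m + degree i l = degree (i + 1) k
  /-- Minimality: the image of each differential lies in `(x_s : s ∈ σ) F i`. -/
  minimal : ∀ i k l, diff i (Pi.single k 1) l ∈
    Ideal.span (Set.range (MvPolynomial.X : σ → MvPolynomial σ K))

/-- The graded Betti number `b_{i,j}` of the ideal `I`: the number of basis vectors of total degree
`j` in the `i`-th module of a multigraded minimal free resolution of `I`. Such a resolution exists
for every monomial ideal in finitely many variables and is unique up to isomorphism; the value is
`0` by convention if there is none. -/
noncomputable def gradedBetti {σ : Type u} {K : Type v} [Field K]
    (I : Ideal (MvPolynomial σ K)) (i j : ℕ) : ℕ :=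
  open Classical in
  if h : Nonempty (MinimalMultigradedResolution I) then
    Nat.card {k : Fin (h.some.rank i) // (h.some.degree i k).degree = j}
  else 0

/-- The depth of the ideal `I`, as a module: the supremum of the lengths of `I`-regular sequences
of elements of the ideal generated by the variables. -/
noncomputable def idealDepth {σ : Type u} {K : Type v} [Field K]
    (I : Ideal (MvPolynomial σ K)) : ℕ∞ :=
  sSup {d : ℕ∞ | ∃ rs : List (MvPolynomial σ K),
    (∀ r ∈ rs, r ∈ Ideal.span (Set.range (MvPolynomial.X : σ → MvPolynomial σ K))) ∧
    RingTheory.Sequence.IsRegular I rs ∧ d = (rs.length : ℕ∞)}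

/-- The projective dimension of the ideal `I`, as a module. -/
noncomputable def idealProjDim {σ : Type u} {K : Type v} [Field K]
    (I : Ideal (MvPolynomial σ K)) : WithBot ℕ∞ :=
  CategoryTheory.projectiveDimension (ModuleCat.of (MvPolynomial σ K) I)

/-- The Castelnuovo–Mumford regularity of the ideal `I`, as a module: the supremum of `j - i` over
the `i` and `j` with `b_{i,j} ≠ 0`. -/
noncomputable def idealRegularity {σ : Type u} {K : Type v} [Field K]
    (I : Ideal (MvPolynomial σ K)) : WithBot (WithTop ℤ) :=
  sSup {r : WithBot (WithTop ℤ) | ∃ i j : ℕ, gradedBetti I i j ≠ 0 ∧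
    r = ((((j : ℤ) - (i : ℤ) : ℤ) : WithTop ℤ) : WithBot (WithTop ℤ))}

/-! The Betti numbers enter only through their vanishing pattern. A basis vector of a minimal
multigraded resolution of an edge ideal has squarefree multidegree (`degree_le_one`), so one of
total degree below `n` misses some vertex `v`. The basis vectors missing `v` form, once the variable
of `v` is set to zero, a minimal resolution of the edge ideal of the card at `v` (`restrict`,
`map_killCompl_edgeIdeal`). Hence nonvanishing of `b_{ij}` for `j < n` is visible on a card, and `j
= n` is the hypothesis: hypergraphs with the same deck have the same nonzero positions in their
Betti tables (`SameDeck.gradedBetti_ne_zero_iff`). No counting over the deck is needed.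

As `gradedBetti` uses a chosen resolution, existence (`nonempty_minimalMultigradedResolution`) and
uniqueness of degrees are needed. The ranks are unique because `Ext^i(I, k)`, with `k` the residue
module, is `k ^ rank i` (`nonempty_ext_linearEquiv`). Applying this to every set of variables and
inverting over subsets recovers the number of basis vectors with each support (`card_support_eq`).

The vanishing pattern determines the three invariants: regularity by definition, projective
dimension as the last nonzero index (`hasProjectiveDimensionLT_iff`), and depth by the
Auslander–Buchsbaum formula (`idealDepth_eq`), the zero ideal being treated apart. -/

section

/-! ### Restriction of resolutions to a subset of the variables -/

namespace MvPolynomial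

variable {σ : Type*} {τ : Type*} {K : Type*} [Field K]

lemma mem_span_range_X_iff {p : MvPolynomial σ K} :
    p ∈ Ideal.span (Set.range (X : σ → MvPolynomial σ K)) ↔ coeff 0 p = 0 := by
  rw [← Set.image_univ, mem_ideal_span_X_image]
  constructor
  · intro h
    by_contra h0
    obtain ⟨i, -, hi⟩ := h 0 (mem_support_iff.2 h0)
    exact hi rfl
  · intro h m hm
    have hm0 : m ≠ 0 := by
      rintro rfl
      exact mem_support_iff.1 hm h
    obtain ⟨i, hi⟩ := Finsupp.ne_iff.1 hm0
    exact ⟨i, trivial, hi⟩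

lemma rename_killCompl_of_support_subset {f : τ → σ} (hf : Function.Injective f)
    {p : MvPolynomial σ K} (h : ∀ m ∈ p.support, (m.support : Set σ) ⊆ Set.range f) :
    rename f (killCompl hf p) = p := by
  conv_rhs => rw [p.as_sum]
  conv_lhs => rw [p.as_sum]
  rw [map_sum, map_sum]
  refine Finset.sum_congr rfl fun m hm => ?_
  rw [killCompl_monomial_eq_monomial_comapDomain_of_subset hf _ (h m hm), rename_monomial,
    Finsupp.mapDomain_comapDomain _ hf _ (h m hm)]

lemma killCompl_eq_zero_of_support {f : τ → σ} (hf : Function.Injective f)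
    {p : MvPolynomial σ K} (h : ∀ m ∈ p.support, ¬ (m.support : Set σ) ⊆ Set.range f) :
    killCompl hf p = 0 := by
  rw [p.as_sum, map_sum]
  exact Finset.sum_eq_zero fun m hm => killCompl_monomial_eq_zero_of_not_subset hf _ (h m hm)

lemma killCompl_surjective {f : τ → σ} (hf : Function.Injective f) :
    Function.Surjective (killCompl (R := K) hf) :=
  fun p => ⟨rename f p, killCompl_rename_app hf p⟩

/-! ### Passing to a subset of the basis and of the variables -/

/-- An enumeration of the basis vectors that satisfy `P`. -/
noncomputable def subIdx {r : ℕ} (P : Fin r → Prop) :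
    Fin (Nat.card {k : Fin r // P k}) ≃ {k : Fin r // P k} :=
  (Finite.equivFin _).symm

open Classical in
/-- The inclusion of the free module over fewer variables on the basis vectors satisfying `P`. -/
noncomputable def subInc (f : τ → σ) {r : ℕ} (P : Fin r → Prop) :
    (Fin (Nat.card {k : Fin r // P k}) → MvPolynomial τ K)
      →ₛₗ[((rename f : MvPolynomial τ K →ₐ[K] MvPolynomial σ K) : MvPolynomial τ K →+* MvPolynomial σ K)]
      (Fin r → MvPolynomial σ K) where
  toFun z k := if h : P k then rename f (z ((subIdx P).symm ⟨k, h⟩)) else 0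
  map_add' z w := by
    ext1 k
    by_cases h : P k <;> simp [h]
  map_smul' a z := by
    ext1 k
    by_cases h : P k <;> simp [h]

/-- The projection to the free module over fewer variables on the basis vectors satisfying `P`. -/
noncomputable def subProj {f : τ → σ} (hf : Function.Injective f) {r : ℕ} (P : Fin r → Prop) :
    (Fin r → MvPolynomial σ K)
      →ₛₗ[((killCompl hf : MvPolynomial σ K →ₐ[K] MvPolynomial τ K) : MvPolynomial σ K →+* MvPolynomial τ K)]
      (Fin (Nat.card {k : Fin r // P k}) → MvPolynomial τ K) where
  toFun u k := killCompl hf (u (subIdx P k).1)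
  map_add' z w := by
    ext1 k
    simp
  map_smul' a z := by
    ext1 k
    simp

/-- `rename` as a semilinear map. -/
noncomputable def renameLinear (f : τ → σ) : MvPolynomial τ K
      →ₛₗ[((rename f : MvPolynomial τ K →ₐ[K] MvPolynomial σ K) : MvPolynomial τ K →+* MvPolynomial σ K)]
      MvPolynomial σ K where
  toFun := rename f
  map_add' := map_add _
  map_smul' := by simp

/-- `killCompl` as a semilinear map. -/
noncomputable def killComplLinear {f : τ → σ} (hf : Function.Injective f) : MvPolynomial σ K
      →ₛₗ[((killCompl hf : MvPolynomial σ K →ₐ[K] MvPolynomial τ K) : MvPolynomial σ K →+* MvPolynomial τ K)]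
      MvPolynomial τ K where
  toFun := killCompl hf
  map_add' := map_add _
  map_smul' := by simp

variable {f : τ → σ} (hf : Function.Injective f) {r : ℕ} (P : Fin r → Prop)

lemma subProj_subInc (z : Fin (Nat.card {k : Fin r // P k}) → MvPolynomial τ K) :
    subProj hf P (subInc f P z) = z := by
  ext1 k
  simp [subProj, subInc, (subIdx P k).2]

lemma subInc_single (k : Fin (Nat.card {k : Fin r // P k})) :
    subInc f P (Pi.single k (1 : MvPolynomial τ K)) = Pi.single (subIdx P k).1 1 := by
  ext1 l
  by_cases h : P l
  · by_cases hk : l = (subIdx P k).1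
    · subst hk
      simp [subInc, (subIdx P k).2]
    · have hne : (subIdx P).symm ⟨l, h⟩ ≠ k := by
        rintro rfl
        simp at hk
      simp [subInc, h, Pi.single_eq_of_ne hk, Pi.single_eq_of_ne hne]
  · have hk : l ≠ (subIdx P k).1 := by
      rintro rfl
      exact h (subIdx P k).2
    simp [subInc, h, Pi.single_eq_of_ne hk]

section Codomain

variable {N N' : Type*} [AddCommGroup N] [Module (MvPolynomial σ K) N] [AddCommGroup N']
  [Module (MvPolynomial τ K) N']
  (ι : N' →ₛₗ[((rename f : MvPolynomial τ K →ₐ[K] MvPolynomial σ K) : MvPolynomial τ K →+* MvPolynomial σ K)] N)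
  (π : N →ₛₗ[((killCompl hf : MvPolynomial σ K →ₐ[K] MvPolynomial τ K) : MvPolynomial σ K →+* MvPolynomial τ K)] N')
  (d : (Fin r → MvPolynomial σ K) →ₗ[MvPolynomial σ K] N)

/-- The restriction of a linear map on a free module to fewer variables and basis vectors. -/
noncomputable def subMap : (Fin (Nat.card {k : Fin r // P k}) → MvPolynomial τ K)
    →ₗ[MvPolynomial τ K] N' where
  toFun z := π (d (subInc f P z))
  map_add' z w := by simp
  map_smul' a z := by simp [map_smulₛₗ]

/-- With `subMap_subProj`, this makes inclusion and projection chain maps between the full and the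
restricted complex. Projection after inclusion is the identity, so exactness passes to the
restricted complex. -/
lemma subInc_subMap (h : ∀ k, P k → ι (π (d (Pi.single k 1))) = d (Pi.single k 1))
    (z : Fin (Nat.card {k : Fin r // P k}) → MvPolynomial τ K) :
    ι (subMap hf P π d z) = d (subInc f P z) := by
  change ι (π (d (subInc f P z))) = d (subInc f P z)
  rw [pi_eq_sum_univ' z]
  simp only [map_sum, map_smulₛₗ]
  refine Finset.sum_congr rfl fun k _ => ?_
  rw [subInc_single, h _ (subIdx P k).2]
  simp

lemma subMap_subProj (h : ∀ k, ¬ P k → π (d (Pi.single k 1)) = 0)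
    (u : Fin r → MvPolynomial σ K) :
    subMap hf P π d (subProj hf P u) = π (d u) := by
  rw [pi_eq_sum_univ' u]
  simp only [map_sum, map_smulₛₗ]
  refine Finset.sum_congr rfl fun k _ => ?_
  by_cases hk : P k
  · obtain ⟨l, hl⟩ := (subIdx P).surjective ⟨k, hk⟩
    have hl' : k = (subIdx P l).1 := by rw [hl]
    rw [hl', ← subInc_single (f := f), subProj_subInc]
    rfl
  · rw [h k hk, smul_zero]
    convert smul_zero _
    convert map_zero (subMap hf P π d)
    ext1 l
    have hl : (subIdx P l).1 ≠ k := by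
      rintro rfl
      exact hk (subIdx P l).2
    simp [subProj, Pi.single_eq_of_ne hl]

end Codomain

end MvPolynomial

open MvPolynomial

namespace MinimalMultigradedResolution

variable {σ τ : Type*} {K : Type*} [Field K] {I : Ideal (MvPolynomial σ K)}
  (R : MinimalMultigradedResolution I)

/-- A multidegree involves only variables in the range of `f`. -/
def Over (f : τ → σ) (i : ℕ) (k : Fin (R.rank i)) : Prop :=
  ((R.degree i k).support : Set σ) ⊆ Set.range f

variable {f : τ → σ} (hf : Function.Injective f)

/-- In a term `x ^ m` times the `l`-th basis vector, `m` and the degree of `l` are both bounded by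
the degree of `k`, so neither involves a discarded variable. -/
lemma subInc_subProj_diff (i : ℕ) (k : Fin (R.rank (i + 1))) (hk : R.Over f (i + 1) k) :
    subInc f (R.Over f i) (subProj hf (R.Over f i) (R.diff i (Pi.single k 1))) =
      R.diff i (Pi.single k 1) := by
  have key : ∀ l, ∀ m ∈ (R.diff i (Pi.single k 1) l).support,
      (m.support : Set σ) ⊆ Set.range f ∧ R.Over f i l := by
    intro l m hm
    have := R.diff_homogeneous i k l m hm
    unfold Over at hk ⊢
    rw [← this] at hk
    constructor
    · refine subset_trans (Finset.coe_subset.2 ?_) hk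
      exact Finsupp.support_mono le_self_add
    · refine subset_trans (Finset.coe_subset.2 ?_) hk
      exact Finsupp.support_mono le_add_self
  ext1 l
  by_cases hl : R.Over f i l
  · simp only [subInc, subProj, LinearMap.coe_mk, AddHom.coe_mk, hl, dif_pos,
      Equiv.apply_symm_apply]
    exact rename_killCompl_of_support_subset hf fun m hm => (key l m hm).1
  · have h0 : R.diff i (Pi.single k 1) l = 0 := by
      rw [← support_eq_empty, Finset.eq_empty_iff_forall_notMem]
      exact fun m hm => hl (key l m hm).2
    simp [subInc, hl, h0]

/-- A surviving term would write the degree of `k` as a sum of two degrees in the retained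
variables. -/
lemma subProj_diff (i : ℕ) (k : Fin (R.rank (i + 1))) (hk : ¬ R.Over f (i + 1) k) :
    subProj hf (R.Over f i) (R.diff i (Pi.single k 1)) = 0 := by
  ext1 l
  refine killCompl_eq_zero_of_support hf fun m hm hm' => hk ?_
  have := R.diff_homogeneous i k _ m hm
  unfold Over
  rw [← this]
  classical
  refine subset_trans (Finset.coe_subset.2 Finsupp.support_add) ?_
  rw [Finset.coe_union]
  exact Set.union_subset hm' (subIdx (R.Over f i) l).2

lemma rename_killCompl_aug (k : Fin (R.rank 0)) (hk : R.Over f 0 k) :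
    renameLinear f (killComplLinear hf (R.aug (Pi.single k 1))) = R.aug (Pi.single k 1) :=
  rename_killCompl_of_support_subset hf fun m hm => by
    rwa [R.aug_homogeneous k m hm]

/-- Restriction of a minimal multigraded resolution to the variables in the range of `f`: the
basis vectors whose degrees involve only these variables form a resolution of the ideal obtained
by setting the other variables to zero. -/
noncomputable def restrict (J : Ideal (MvPolynomial τ K)) (hJ : I.map (killCompl hf) = J) :
    MinimalMultigradedResolution J where
  rank i := Nat.card {k // R.Over f i k}
  degree i k := (R.degree i (subIdx (R.Over f i) k).1).comapDomain f hf.injOn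
  aug := subMap hf (R.Over f 0)
    (killComplLinear hf) R.aug
  diff i := subMap hf (R.Over f (i + 1)) (subProj hf (R.Over f i)) (R.diff i)
  range_aug := by
    rw [← hJ]
    ext p
    rw [Ideal.mem_map_iff_of_surjective _ (killCompl_surjective hf)]
    constructor
    · rintro ⟨z, rfl⟩
      refine ⟨R.aug (subInc f (R.Over f 0) z), ?_, rfl⟩
      exact R.range_aug.le ⟨_, rfl⟩
    · rintro ⟨q, hq, rfl⟩
      obtain ⟨u, rfl⟩ := R.range_aug.ge hq
      refine ⟨subProj hf _ u, subMap_subProj hf (R.Over f 0) _ R.aug ?_ u⟩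
      intro k hk
      refine killCompl_eq_zero_of_support hf fun m hm hm' => hk ?_
      unfold Over
      rwa [← R.aug_homogeneous k m hm]
  exact_aug := by
    intro z
    constructor
    · intro hz
      -- The inclusion of the cycle `z` is a cycle of the full complex. It bounds some `u` there,
      -- and the projection of `u` bounds `z`.
      have h1 := subInc_subMap hf (R.Over f 0) (renameLinear f)
        (killComplLinear hf) R.aug (R.rename_killCompl_aug hf) z
      rw [hz, map_zero] at h1
      obtain ⟨u, hu⟩ := (R.exact_aug _).1 h1.symm
      refine ⟨subProj hf _ u, ?_⟩
      rw [subMap_subProj hf _ _ _ (R.subProj_diff hf 0), hu, subProj_subInc]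
    · rintro ⟨w, rfl⟩
      change killComplLinear hf (R.aug (subInc f _ (subMap hf _ _ _ w))) = 0
      rw [subInc_subMap hf _ _ _ _ (R.subInc_subProj_diff hf 0),
        R.exact_aug.apply_apply_eq_zero, map_zero]
  exact_diff i := by
    intro z
    constructor
    · intro hz
      have h1 := subInc_subMap hf (R.Over f (i + 1)) (subInc f (R.Over f i))
        (subProj hf (R.Over f i)) (R.diff i) (R.subInc_subProj_diff hf i) z
      rw [hz, map_zero] at h1
      obtain ⟨u, hu⟩ := (R.exact_diff i _).1 h1.symm
      refine ⟨subProj hf _ u, ?_⟩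
      rw [subMap_subProj hf _ _ _ (R.subProj_diff hf (i + 1)), hu, subProj_subInc]
    · rintro ⟨w, rfl⟩
      change subProj hf _ (R.diff i (subInc f _ (subMap hf _ _ _ w))) = 0
      rw [subInc_subMap hf _ _ _ _ (R.subInc_subProj_diff hf (i + 1)),
        (R.exact_diff i).apply_apply_eq_zero, map_zero]
  aug_homogeneous k m hm := by
    replace hm : m ∈ (killCompl hf (R.aug (subInc f (R.Over f 0) (Pi.single k 1)))).support := hm
    rw [subInc_single, support_killCompl, Finset.mem_preimage] at hm
    rw [← R.aug_homogeneous _ _ hm, Finsupp.comapDomain_mapDomain _ hf]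
  diff_homogeneous i k l m hm := by
    replace hm : m ∈ (killCompl hf (R.diff i (subInc f (R.Over f (i + 1)) (Pi.single k 1))
      (subIdx (R.Over f i) l).1)).support := hm
    rw [subInc_single, support_killCompl, Finset.mem_preimage] at hm
    rw [← R.diff_homogeneous i _ _ _ hm, Finsupp.comapDomain_add_of_injective hf,
      Finsupp.comapDomain_mapDomain _ hf]
  minimal i k l := by
    change killCompl hf (R.diff i (subInc f (R.Over f (i + 1)) (Pi.single k 1))
      (subIdx (R.Over f i) l).1) ∈ _
    have := R.minimal i (subIdx _ k).1 (subIdx (R.Over f i) l).1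
    rw [mem_span_range_X_iff] at this ⊢
    rw [coeff_killCompl, subInc_single, Finsupp.mapDomain_zero, this]

end MinimalMultigradedResolution

end

/-! ### Edge ideals and squarefree multidegrees -/

section

open MvPolynomial

lemma MvPolynomial.prod_X_eq_monomial_indicator {σ K : Type*} [Field K] (e : Finset σ) :
    ∏ s ∈ e, (X s : MvPolynomial σ K) = monomial (Finsupp.indicator e fun _ _ => 1) 1 := by
  classical
  rw [show (∏ s ∈ e, (X s : MvPolynomial σ K)) = ∏ s ∈ e, monomial (Finsupp.single s 1) 1 from rfl,
    ← MvPolynomial.monomial_sum_one]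
  refine congrArg (fun a => monomial a (1 : K)) ?_
  ext s
  simp [Finsupp.finsetSum_apply, Finsupp.single_apply, Finsupp.indicator_apply]

namespace SpernerHypergraph

variable (K : Type v) [Field K] {V W : Type u} (H : SpernerHypergraph V)

lemma mem_edgeIdeal_iff {p : MvPolynomial V K} :
    p ∈ H.edgeIdeal K ↔ ∀ m ∈ p.support, ∃ e ∈ H.edges, e ⊆ m.support := by
  have : H.edgeIdeal K = Ideal.span ((fun s => monomial s (1 : K)) ''
      ((fun e : Finset V => Finsupp.indicator e fun _ _ => 1) '' H.edges)) := by
    rw [Set.image_image, edgeIdeal]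
    simp only [prod_X_eq_monomial_indicator]
  rw [this, mem_ideal_span_monomial_image]
  simp only [Set.mem_image, exists_exists_and_eq_and]
  refine forall₂_congr fun m _ => exists_congr fun e => and_congr_right fun _ => ?_
  classical
  constructor
  · intro h v hv
    have := h v
    simp only [Finsupp.indicator_apply, hv, dite_true] at this
    exact Finsupp.mem_support_iff.2 (by omega)
  · intro h v
    by_cases hv : v ∈ e
    · simp only [Finsupp.indicator_apply, hv, dite_true]
      exact Nat.one_le_iff_ne_zero.2 (Finsupp.mem_support_iff.1 (h hv))
    · simp [Finsupp.indicator_apply, hv]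

/-- Setting the variables outside the range of `f` to zero kills exactly the generators of edges
that leave the range. This is the algebraic form of passing to an induced subhypergraph. -/
lemma map_killCompl_edgeIdeal (H' : SpernerHypergraph W) (f : W ↪ V)
    (hf : ∀ e : Finset W, e.map f ∈ H.edges ↔ e ∈ H'.edges) :
    (H.edgeIdeal K).map (killCompl (R := K) f.injective) = H'.edgeIdeal K := by
  classical
  rw [edgeIdeal, Ideal.map_span]
  apply le_antisymm
  · rw [Ideal.span_le]
    rintro _ ⟨_, ⟨e, he, rfl⟩, rfl⟩
    by_cases hs : (e : Set V) ⊆ Set.range f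
    · obtain ⟨e', rfl⟩ : ∃ e' : Finset W, e'.map f = e := by
        refine ⟨e.preimage f f.injective.injOn, ?_⟩
        rw [Finset.map_eq_image, Finset.image_preimage, Finset.filter_true_of_mem]
        exact fun x hx => hs hx
      refine Ideal.subset_span ⟨e', (hf e').1 he, ?_⟩
      simp only [Finset.prod_map, map_prod]
      refine Finset.prod_congr rfl fun w _ => ?_
      rw [← rename_X f, killCompl_rename_app]
    · obtain ⟨v, hv, hvf⟩ := Set.not_subset.1 hs
      have : killCompl f.injective (∏ v ∈ e, (X v : MvPolynomial V K)) = 0 := by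
        rw [map_prod]
        refine Finset.prod_eq_zero hv ?_
        rw [killCompl, aeval_X, dif_neg hvf]
      rw [this]
      exact zero_mem _
  · rw [edgeIdeal, Ideal.span_le]
    rintro _ ⟨e, he, rfl⟩
    refine Ideal.subset_span ⟨_, ⟨e.map f, (hf e).2 he, rfl⟩, ?_⟩
    simp only [Finset.prod_map, map_prod]
    refine Finset.prod_congr rfl fun w _ => ?_
    rw [← rename_X f, killCompl_rename_app]

end SpernerHypergraph

lemma Finsupp.degree_eq_card_support {σ : Type*} {a : σ →₀ ℕ} (h : ∀ s, a s ≤ 1) :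
    a.degree = a.support.card := by
  rw [Finsupp.degree_apply, Finset.card_eq_sum_ones]
  refine Finset.sum_congr rfl fun s hs => ?_
  have := Finsupp.mem_support_iff.1 hs
  have := h s
  omega

namespace MinimalMultigradedResolution

section General

variable {σ : Type*} {K : Type*} [Field K] {I : Ideal (MvPolynomial σ K)}
  (R : MinimalMultigradedResolution I)

lemma diff_apply_mem (i : ℕ) (u : Fin (R.rank (i + 1)) → MvPolynomial σ K) (l : Fin (R.rank i)) :
    R.diff i u l ∈ Ideal.span (Set.range (X : σ → MvPolynomial σ K)) := by
  rw [pi_eq_sum_univ' u]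
  simp only [map_sum, map_smul, Finset.sum_apply, Pi.smul_apply, smul_eq_mul]
  exact Ideal.sum_mem _ fun k _ => Ideal.mul_mem_left _ _ (R.minimal i k l)

/-- Otherwise a basis vector is a boundary, although by minimality boundaries have coordinates
without constant term. -/
lemma diff_single_ne_zero (i : ℕ) (k : Fin (R.rank (i + 1))) : R.diff i (Pi.single k 1) ≠ 0 := by
  intro h
  obtain ⟨u, hu⟩ := (R.exact_diff i _).1 h
  have := R.diff_apply_mem (i + 1) u k
  rw [hu, mem_span_range_X_iff] at this
  simp at this

lemma le_degree (i : ℕ) (k : Fin (R.rank i)) : i ≤ (R.degree i k).degree := by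
  induction i with
  | zero => simp
  | succ i ih =>
    obtain ⟨l, hl⟩ := Function.ne_iff.1 (R.diff_single_ne_zero i k)
    obtain ⟨m, hm⟩ := support_nonempty.2 hl
    rw [← R.diff_homogeneous i k l m hm, map_add]
    have hm0 : m ≠ 0 := by
      rintro rfl
      exact mem_support_iff.1 hm (mem_span_range_X_iff.1 (R.minimal i k l))
    have := Finsupp.degree_eq_zero_iff m |>.not.2 hm0
    have := ih l
    omega

end General

variable {K : Type v} [Field K] {V : Type u} {H : SpernerHypergraph V}
  (R : MinimalMultigradedResolution (H.edgeIdeal K))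

/-- The resolution of an edge ideal is concentrated in squarefree multidegrees. -/
lemma degree_le_one (i : ℕ) (k : Fin (R.rank i)) (s : V) : R.degree i k s ≤ 1 := by
  classical
  induction i with
  | zero =>
    by_contra! h
    set p := R.aug (Pi.single k 1) with hp
    have hdvd : X s ∣ p := by
      rw [X_dvd_iff_modMonomial_eq_zero]
      ext m
      rw [coeff_zero]
      by_cases hm : Finsupp.single s 1 ≤ m
      · exact coeff_modMonomial_of_le _ hm
      · rw [coeff_modMonomial_of_not_le _ hm]
        by_contra hc
        rw [R.aug_homogeneous k m (mem_support_iff.2 hc)] at hm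
        exact hm (Finsupp.single_le_iff.2 (by omega))
    obtain ⟨q, hq⟩ := hdvd
    -- The exponent of `s` is at least 2, so removing one factor `X s` keeps the support, and
    -- membership in the edge ideal depends only on supports.
    have hqI : q ∈ H.edgeIdeal K := by
      rw [SpernerHypergraph.mem_edgeIdeal_iff]
      intro m hm
      have hm' : Finsupp.single s 1 + m ∈ p.support := by
        rw [hq, mem_support_iff, coeff_X_mul]
        exact mem_support_iff.1 hm
      have hpI : p ∈ H.edgeIdeal K := R.range_aug.le ⟨_, rfl⟩
      rw [SpernerHypergraph.mem_edgeIdeal_iff] at hpI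
      obtain ⟨e, he, hem⟩ := hpI _ hm'
      refine ⟨e, he, hem.trans ?_⟩
      have hdeg := R.aug_homogeneous k _ hm'
      intro v hv
      rw [Finsupp.mem_support_iff] at hv ⊢
      by_cases hvs : v = s
      · subst hvs
        have := congrArg (· v) hdeg
        simp at this
        omega
      · simpa [Finsupp.single_apply, Ne.symm hvs] using hv
    obtain ⟨u, hu⟩ := R.range_aug.ge hqI
    -- This cycle has constant term 1 in coordinate `k`, which minimality forbids.
    have h0 : R.aug (Pi.single k 1 - (X s : MvPolynomial V K) • u) = 0 := by
      rw [map_sub, map_smul, hu, ← hp, hq, smul_eq_mul, sub_self]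
    obtain ⟨w, hw⟩ := (R.exact_aug _).1 h0
    have := R.diff_apply_mem 0 w k
    rw [hw, mem_span_range_X_iff] at this
    simp [coeff_X_mul'] at this
  | succ i ih =>
    by_contra! h
    set p := R.diff i (Pi.single k 1) with hp
    -- By induction the degree of `l` has exponent at most 1 at `s`, so the coefficient supplies at
    -- least one further factor `X s`.
    have hdvd : ∀ l, X s ∣ p l := by
      intro l
      rw [X_dvd_iff_modMonomial_eq_zero]
      ext m
      rw [coeff_zero]
      by_cases hm : Finsupp.single s 1 ≤ m
      · exact coeff_modMonomial_of_le _ hm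
      · rw [coeff_modMonomial_of_not_le _ hm]
        by_contra hc
        have h1 := R.diff_homogeneous i k l m (mem_support_iff.2 hc)
        have h2 := ih l
        have h3 := congrArg (· s) h1
        simp only [Finsupp.add_apply] at h3
        exact hm (Finsupp.single_le_iff.2 (by omega))
    choose q hq using hdvd
    have hpq : p = (X s : MvPolynomial V K) • q := funext hq
    -- As `X s` is a nonzerodivisor, `q` is a cycle along with `X s • q`, hence a boundary.
    have hex : ∃ u, R.diff i u = q := by
      cases i with
      | zero =>
        refine (R.exact_aug q).1 ?_
        have := R.exact_aug.apply_apply_eq_zero (Pi.single k 1)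
        rw [← hp, hpq, map_smul, smul_eq_mul] at this
        exact (mul_eq_zero.1 this).resolve_left (X_ne_zero s)
      | succ i =>
        refine (R.exact_diff i q).1 ?_
        have := (R.exact_diff i).apply_apply_eq_zero (Pi.single k 1)
        rw [← hp, hpq, map_smul] at this
        exact (smul_eq_zero.1 this).resolve_left (X_ne_zero s)
    obtain ⟨u, hu⟩ := hex
    have h0 : R.diff i (Pi.single k 1 - (X s : MvPolynomial V K) • u) = 0 := by
      rw [map_sub, map_smul, hu, ← hp, hpq, sub_self]
    obtain ⟨w, hw⟩ := (R.exact_diff i _).1 h0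
    have := R.diff_apply_mem (i + 1) w k
    rw [hw, mem_span_range_X_iff] at this
    simp [coeff_X_mul'] at this

lemma degree_degree (i : ℕ) (k : Fin (R.rank i)) :
    (R.degree i k).degree = (R.degree i k).support.card :=
  Finsupp.degree_eq_card_support (R.degree_le_one i k)

lemma degree_degree_le [Finite V] (i : ℕ) (k : Fin (R.rank i)) :
    (R.degree i k).degree ≤ Nat.card V := by
  have := Fintype.ofFinite V
  rw [R.degree_degree, Nat.card_eq_fintype_card]
  exact Finset.card_le_univ _

/-- Minimality forces total degree at least `i`, squarefreeness at most the number of vertices. -/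
lemma rank_eq_zero [Finite V] {i : ℕ} (hi : Nat.card V < i) : R.rank i = 0 := by
  by_contra h
  let k : Fin (R.rank i) := ⟨0, Nat.pos_of_ne_zero h⟩
  have := R.le_degree i k
  have := R.degree_degree_le i k
  omega

end MinimalMultigradedResolution

end

/-! ### `Ext` into the residue field: uniqueness of ranks and projective dimension -/

section

open MvPolynomial CategoryTheory Abelian

namespace MinimalMultigradedResolution

variable {σ : Type u} {K : Type v} [Field K] {I : Ideal (MvPolynomial σ K)}
  (R : MinimalMultigradedResolution I)

variable (σ K) in
/-- The residue field of the ideal generated by the variables, as a module. -/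
noncomputable abbrev residueModule : ModuleCat.{max u v} (MvPolynomial σ K) :=
  ModuleCat.of _ (MvPolynomial σ K ⧸ Ideal.span (Set.range (X : σ → MvPolynomial σ K)))

/-- The modules of the resolution. -/
noncomputable abbrev freeModule (i : ℕ) : ModuleCat.{max u v} (MvPolynomial σ K) :=
  ModuleCat.of _ (Fin (R.rank i) → MvPolynomial σ K)

/-- The syzygy modules of the resolution, beginning with the ideal itself. -/
noncomputable def syzygy : ℕ → ModuleCat.{max u v} (MvPolynomial σ K)
  | 0 => ModuleCat.of _ I
  | i + 1 => ModuleCat.of _ (LinearMap.range (R.diff i))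

/-- The surjection of the `i`-th module of the resolution onto the `i`-th syzygy module. -/
noncomputable def cover : ∀ i, (Fin (R.rank i) → MvPolynomial σ K) →ₗ[MvPolynomial σ K] R.syzygy i
  | 0 => R.aug.codRestrict I fun u => R.range_aug.le ⟨u, rfl⟩
  | i + 1 => (R.diff i).rangeRestrict

lemma cover_surjective : ∀ i, Function.Surjective (R.cover i)
  | 0 => fun x => by
    obtain ⟨u, hu⟩ := R.range_aug.ge x.2
    exact ⟨u, Subtype.ext hu⟩
  | i + 1 => (R.diff i).surjective_rangeRestrict

lemma cover_eq_zero_iff : ∀ i u, R.cover i u = 0 ↔ u ∈ LinearMap.range (R.diff i)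
  | 0, u => by
    rw [LinearMap.mem_range, ← Set.mem_range, ← R.exact_aug u]
    exact Subtype.ext_iff
  | i + 1, u => by
    rw [LinearMap.mem_range, ← Set.mem_range, ← R.exact_diff i u]
    exact Subtype.ext_iff

/-- The short complex `0 → syzygy (i + 1) → F i → syzygy i → 0`. -/
noncomputable abbrev syzygyComplex (i : ℕ) : ShortComplex (ModuleCat.{max u v} (MvPolynomial σ K)) :=
  ModuleCat.shortComplexOfCompEqZero (L := R.syzygy i) (LinearMap.range (R.diff i)).subtype
    (R.cover i) (by
      ext1 x
      exact (R.cover_eq_zero_iff i _).2 x.2)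

lemma syzygyComplex_shortExact (i : ℕ) : (R.syzygyComplex i).ShortExact := by
  refine ModuleCat.shortComplex_shortExact _ ?_ ?_ (R.cover_surjective i)
  · intro u
    refine (R.cover_eq_zero_iff i u).trans ?_
    change _ ↔ u ∈ Set.range (LinearMap.range (R.diff i)).subtype
    simp
  · exact Subtype.val_injective

lemma map_range_diff_eq_zero (i : ℕ)
    (g : (Fin (R.rank i) → MvPolynomial σ K) →ₗ[MvPolynomial σ K] residueModule σ K)
    {x : Fin (R.rank i) → MvPolynomial σ K} (hx : x ∈ LinearMap.range (R.diff i)) : g x = 0 := by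
  obtain ⟨u, rfl⟩ := hx
  rw [pi_eq_sum_univ' (R.diff i u), map_sum]
  refine Finset.sum_eq_zero fun l _ => ?_
  rw [map_smul]
  obtain ⟨y, hy⟩ := Ideal.Quotient.mk_surjective (g (Pi.single l 1))
  rw [← hy, ← Ideal.Quotient.mk_eq_mk, ← Submodule.Quotient.mk_smul,
    Submodule.Quotient.mk_eq_zero]
  exact Ideal.mul_mem_right _ _ (R.diff_apply_mem i u l)

/-- Dimension shifting along the free module `F i`. It remains injective for `n = 0` because, by
minimality, every map from `F i` to the residue module vanishes on the next syzygy module. -/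
lemma extClass_comp_bijective (i n : ℕ) : Function.Bijective
    ((R.syzygyComplex_shortExact i).extClass.precomp (residueModule σ K) (add_comm 1 n)) := by
  refine ⟨?_, ?_⟩
  · rw [injective_iff_map_eq_zero]
    intro x hx
    obtain ⟨y, rfl⟩ := Ext.contravariant_sequence_exact₁ (R.syzygyComplex_shortExact i) _ x
      (add_comm 1 n) hx
    cases n with
    | succ n =>
      rw [Ext.eq_zero_of_projective y, Ext.comp_zero]
    | zero =>
      obtain ⟨g, rfl⟩ := (Ext.mk₀_bijective _ _).2 y
      rw [Ext.mk₀_comp_mk₀, Ext.mk₀_eq_zero_iff]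
      ext x
      exact R.map_range_diff_eq_zero i g.hom x.2
  · exact precomp_extClass_surjective_of_projective_X₂ _
      (R.syzygyComplex_shortExact i) n

/-- By minimality every map from `F i` to the residue module factors through the cover, and such a
map is a free choice of images of the basis vectors. -/
lemma nonempty_linearEquiv_hom (i : ℕ) : Nonempty ((R.syzygy i →ₗ[MvPolynomial σ K]
    residueModule σ K) ≃ₗ[MvPolynomial σ K] (Fin (R.rank i) → residueModule σ K)) := by
  refine ⟨(LinearEquiv.ofBijective (LinearMap.lcomp (MvPolynomial σ K) (residueModule σ K)
    (R.cover i)) ⟨?_, ?_⟩).trans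
      ((Pi.basisFun (MvPolynomial σ K) (Fin (R.rank i))).constr (MvPolynomial σ K)).symm⟩
  · intro a b h
    ext x
    obtain ⟨u, rfl⟩ := R.cover_surjective i x
    exact LinearMap.congr_fun h u
  · intro g
    have hker : LinearMap.ker (R.cover i) ≤ LinearMap.ker g := fun x hx =>
      R.map_range_diff_eq_zero i g ((R.cover_eq_zero_iff i x).1 hx)
    refine ⟨((LinearMap.ker (R.cover i)).liftQ g hker).comp
      ((R.cover i).quotKerEquivOfSurjective (R.cover_surjective i)).symm.toLinearMap, ?_⟩
    refine LinearMap.ext fun u => ?_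
    simp only [LinearMap.lcomp_apply, LinearMap.comp_apply, LinearEquiv.coe_coe]
    have : ((R.cover i).quotKerEquivOfSurjective (R.cover_surjective i)).symm (R.cover i u) =
        Submodule.Quotient.mk u := by
      rw [LinearEquiv.symm_apply_eq]
      rfl
    rw [this]
    rfl

lemma nonempty_ext_linearEquiv (n i : ℕ) : Nonempty (Ext (R.syzygy i) (residueModule σ K) n
    ≃ₗ[MvPolynomial σ K] (Fin (R.rank (i + n)) → residueModule σ K)) := by
  induction n generalizing i with
  | zero =>
    obtain ⟨e⟩ := R.nonempty_linearEquiv_hom i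
    exact ⟨(Ext.linearEquiv₀.trans ModuleCat.homLinearEquiv).trans e⟩
  | succ n ih =>
    obtain ⟨e⟩ := ih (i + 1)
    rw [show i + (n + 1) = i + 1 + n by omega]
    let c : Ext (R.syzygy (i + 1)) (residueModule σ K) n →ₗ[MvPolynomial σ K]
        Ext (R.syzygy i) (residueModule σ K) (n + 1) :=
      { (R.syzygyComplex_shortExact i).extClass.precomp (residueModule σ K) (add_comm 1 n) with
        map_smul' := fun a x => Ext.comp_smul _ _ (add_comm 1 n) _ }
    exact ⟨(LinearEquiv.ofBijective c (R.extClass_comp_bijective i n)).symm.trans e⟩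

lemma span_range_X_ne_top : Ideal.span (Set.range (X : σ → MvPolynomial σ K)) ≠ ⊤ := by
  rw [Ne, Ideal.eq_top_iff_one, mem_span_range_X_iff]
  simp

instance : Nontrivial (MvPolynomial σ K ⧸ Ideal.span (Set.range (X : σ → MvPolynomial σ K))) :=
  Ideal.Quotient.nontrivial_iff.2 span_range_X_ne_top

/-- The ranks of a minimal resolution depend only on the ideal. -/
lemma rank_eq_rank (R' : MinimalMultigradedResolution I) (i : ℕ) : R.rank i = R'.rank i := by
  obtain ⟨e⟩ := R.nonempty_ext_linearEquiv i 0
  obtain ⟨e'⟩ := R'.nonempty_ext_linearEquiv i 0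
  rw [zero_add] at e e'
  have e'' : (Fin (R.rank i) → (MvPolynomial σ K ⧸ Ideal.span (Set.range
      (X : σ → MvPolynomial σ K)))) ≃ₗ[MvPolynomial σ K] (Fin (R'.rank i) → (MvPolynomial σ K ⧸
        Ideal.span (Set.range (X : σ → MvPolynomial σ K)))) := e.symm.trans e'
  have := (e''.extendScalarsOfSurjective (S := MvPolynomial σ K ⧸ Ideal.span (Set.range
      (X : σ → MvPolynomial σ K))) Ideal.Quotient.mk_surjective)
  exact Fin.equiv_iff_eq.1 ⟨(Fintype.equivOfCardEq (card_eq_of_linearEquiv _ this))⟩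

lemma hasProjectiveDimensionLT_syzygy (N i : ℕ) (h : ∀ j, i + N ≤ j → R.rank j = 0) :
    HasProjectiveDimensionLT (R.syzygy i) N := by
  induction N generalizing i with
  | zero =>
    rw [hasProjectiveDimensionLT_zero_iff_isZero, ModuleCat.isZero_iff_subsingleton]
    have : IsEmpty (Fin (R.rank i)) := by
      rw [h i le_rfl]
      infer_instance
    exact (R.cover_surjective i).subsingleton
  | succ N ih =>
    exact (R.syzygyComplex_shortExact i).hasProjectiveDimensionLT_X₃ N
      (ih (i + 1) fun j hj => h j (by omega))
      (hasProjectiveDimensionLT_of_ge _ 1 _ (by omega))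

/-- A nonzero rank at `i` is a nonzero `Ext` group in degree `i`; conversely a truncated resolution
bounds the dimension. -/
lemma hasProjectiveDimensionLT_iff (N : ℕ) :
    HasProjectiveDimensionLT (ModuleCat.of (MvPolynomial σ K) I) N ↔ ∀ i, N ≤ i → R.rank i = 0 := by
  constructor
  · intro h i hi
    have h1 : Subsingleton (Ext (R.syzygy 0) (residueModule σ K) i) :=
      HasProjectiveDimensionLT.subsingleton (ModuleCat.of (MvPolynomial σ K) I) N i hi (residueModule σ K)
    obtain ⟨e⟩ := R.nonempty_ext_linearEquiv i 0
    rw [zero_add] at e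
    have h2 : Subsingleton (Fin (R.rank i) → residueModule σ K) :=
      e.symm.toEquiv.subsingleton
    by_contra h0
    have : Nonempty (Fin (R.rank i)) := ⟨⟨0, Nat.pos_of_ne_zero h0⟩⟩
    exact not_subsingleton (Fin (R.rank i) → residueModule σ K) h2
  · intro h
    exact R.hasProjectiveDimensionLT_syzygy N 0 (by simpa using h)

end MinimalMultigradedResolution

end

/-! ### Existence of minimal multigraded resolutions -/

section

open MvPolynomial

namespace MvPolynomial

variable {σ : Type u} {K : Type v} [Field K]

/-- The component of degree `a` of a polynomial seen as an element of `A(-b)`. -/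
noncomputable def shiftedComponent (b a : σ →₀ ℕ) : MvPolynomial σ K →+ MvPolynomial σ K :=
  open Classical in
  if b ≤ a then ((monomial (a - b)).toAddMonoidHom.comp (coeffAddMonoidHom (a - b))) else 0

lemma shiftedComponent_of_le {b a : σ →₀ ℕ} (h : b ≤ a) (p : MvPolynomial σ K) :
    shiftedComponent b a p = monomial (a - b) (coeff (a - b) p) := by
  simp [shiftedComponent, h]

lemma shiftedComponent_of_not_le {b a : σ →₀ ℕ} (h : ¬ b ≤ a) (p : MvPolynomial σ K) :
    shiftedComponent b a p = 0 := by
  simp [shiftedComponent, h]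

/-- The hypothesis leaves `p` at most one term, and multiplication by it is a degree-preserving map
from `A(-b')` to `A(-b)`. -/
lemma shiftedComponent_mul {b b' : σ →₀ ℕ} (a : σ →₀ ℕ) (c : MvPolynomial σ K)
    {p : MvPolynomial σ K} (hp : ∀ m ∈ p.support, m + b = b') :
    shiftedComponent b a (c * p) = shiftedComponent b' a c * p := by
  classical
  by_cases h0 : p = 0
  · simp [h0]
  obtain ⟨m, hm⟩ := support_nonempty.2 h0
  have hpm : p = monomial m (coeff m p) := by
    ext m'
    rw [coeff_monomial]
    split_ifs with h
    · rw [h]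
    · by_contra hc
      exact h (add_right_cancel ((hp m hm).trans (hp m' (mem_support_iff.2 hc)).symm))
  obtain rfl := hp m hm
  generalize coeff m p = t at hpm
  subst hpm
  by_cases hb : b ≤ a
  · rw [shiftedComponent_of_le hb, coeff_mul_monomial']
    by_cases hmb : m + b ≤ a
    · have hm' : m ≤ a - b := le_tsub_of_add_le_right hmb
      rw [shiftedComponent_of_le hmb, if_pos hm', monomial_mul, tsub_tsub, add_comm b m]
      congr 2
      rw [add_comm m b, ← tsub_tsub, tsub_add_cancel_of_le hm']
    · have hm' : ¬ m ≤ a - b := fun h => hmb ((le_tsub_iff_right hb).1 h)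
      rw [shiftedComponent_of_not_le hmb, if_neg hm']
      simp
  · have hmb : ¬ m + b ≤ a := fun h => hb (le_add_self.trans h)
    rw [shiftedComponent_of_not_le hb, shiftedComponent_of_not_le hmb, zero_mul]

variable {r : ℕ} (deg : Fin r → σ →₀ ℕ)

/-- The component of degree `a` of an element of `⨁ A(-deg l)`. -/
noncomputable def gradedComponent (a : σ →₀ ℕ) :
    (Fin r → MvPolynomial σ K) →+ (Fin r → MvPolynomial σ K) where
  toFun z l := shiftedComponent (deg l) a (z l)
  map_zero' := by
    ext1 l
    simp
  map_add' z w := by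
    ext1 l
    simp

/-- An element of `⨁ A(-deg l)` is homogeneous of degree `a`. -/
def IsGradedHomogeneous (a : σ →₀ ℕ) (z : Fin r → MvPolynomial σ K) : Prop :=
  ∀ l, ∀ m ∈ (z l).support, m + deg l = a

lemma gradedComponent_smul {b : σ →₀ ℕ} (a : σ →₀ ℕ) (c : MvPolynomial σ K)
    {z : Fin r → MvPolynomial σ K} (hz : IsGradedHomogeneous deg b z) :
    gradedComponent deg a (c • z) = shiftedComponent b a c • z := by
  ext1 l
  exact shiftedComponent_mul a c (hz l)

lemma isGradedHomogeneous_gradedComponent (a : σ →₀ ℕ) (z : Fin r → MvPolynomial σ K) :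
    IsGradedHomogeneous deg a (gradedComponent deg a z) := by
  classical
  intro l m hm
  change m ∈ (shiftedComponent (deg l) a (z l)).support at hm
  by_cases h : deg l ≤ a
  · rw [shiftedComponent_of_le h] at hm
    have := Finset.mem_singleton.1 (support_monomial_subset hm)
    rw [this, tsub_add_cancel_of_le h]
  · rw [shiftedComponent_of_not_le h] at hm
    simp at hm

lemma exists_sum_gradedComponent (z : Fin r → MvPolynomial σ K) :
    ∃ S : Finset (σ →₀ ℕ), ∑ a ∈ S, gradedComponent deg a z = z := by
  classical
  refine ⟨Finset.univ.biUnion fun l => (z l).support.image (· + deg l), ?_⟩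
  ext l m
  rw [Finset.sum_apply, coeff_sum]
  have key : ∀ a, coeff m (gradedComponent deg a z l) =
      if m + deg l = a then coeff m (z l) else 0 := by
    intro a
    change coeff m (shiftedComponent (deg l) a (z l)) = _
    by_cases h : deg l ≤ a
    · rw [shiftedComponent_of_le h, coeff_monomial]
      have : a - deg l = m ↔ m + deg l = a := by
        rw [tsub_eq_iff_eq_add_of_le h, eq_comm]
      by_cases h' : m + deg l = a
      · rw [if_pos h', if_pos (this.2 h'), this.2 h']
      · rw [if_neg h', if_neg (this.not.2 h')]
    · rw [shiftedComponent_of_not_le h, if_neg, coeff_zero]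
      rintro rfl
      exact h le_add_self
  simp only [key]
  rw [Finset.sum_ite_eq]
  split_ifs with h
  · rfl
  · by_contra hc
    refine h (Finset.mem_biUnion.2 ⟨l, Finset.mem_univ _, Finset.mem_image_of_mem _ ?_⟩)
    exact mem_support_iff.2 (Ne.symm hc)

/-- A submodule of `⨁ A(-deg l)` is graded. -/
def IsGradedSubmodule (Z : Submodule (MvPolynomial σ K) (Fin r → MvPolynomial σ K)) : Prop :=
  ∀ a, ∀ z ∈ Z, gradedComponent deg a z ∈ Z

lemma IsGradedSubmodule.span_eq {Z : Submodule (MvPolynomial σ K) (Fin r → MvPolynomial σ K)}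
    (hZ : IsGradedSubmodule deg Z) :
    Submodule.span (MvPolynomial σ K) {z | z ∈ Z ∧ ∃ a, IsGradedHomogeneous deg a z} = Z := by
  apply le_antisymm
  · rw [Submodule.span_le]
    exact fun z hz => hz.1
  · intro z hz
    obtain ⟨S, hS⟩ := exists_sum_gradedComponent deg z
    rw [← hS]
    exact Submodule.sum_mem _ fun a _ => Submodule.subset_span
      ⟨hZ a z hz, a, isGradedHomogeneous_gradedComponent deg a z⟩

/-- A graded submodule is the image of a minimal multigraded free module. -/
lemma IsGradedSubmodule.exists_cover [Finite σ]
    {Z : Submodule (MvPolynomial σ K) (Fin r → MvPolynomial σ K)}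
    (hZ : IsGradedSubmodule deg Z) :
    ∃ (s : ℕ) (deg' : Fin s → σ →₀ ℕ)
      (d : (Fin s → MvPolynomial σ K) →ₗ[MvPolynomial σ K] (Fin r → MvPolynomial σ K)),
      LinearMap.range d = Z ∧
      (∀ k, IsGradedHomogeneous deg (deg' k) (d (Pi.single k 1))) ∧
      (∀ u, d u = 0 → ∀ k, u k ∈ Ideal.span (Set.range (X : σ → MvPolynomial σ K))) ∧
      IsGradedSubmodule deg' (LinearMap.ker d) := by
  classical
  -- Minimality will come from taking the least possible number of homogeneous generators.
  let Q : ℕ → Prop := fun s => ∃ g : Fin s → Fin r → MvPolynomial σ K,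
    (∀ k, g k ∈ Z ∧ ∃ a, IsGradedHomogeneous deg a (g k)) ∧
      Submodule.span (MvPolynomial σ K) (Set.range g) = Z
  have hQ : ∃ s, Q s := by
    have hfg : (Submodule.span (MvPolynomial σ K)
        {z | z ∈ Z ∧ ∃ a, IsGradedHomogeneous deg a z}).FG := IsNoetherian.noetherian _
    rw [Submodule.fg_span_iff_fg_span_finset_subset] at hfg
    obtain ⟨S, hS, hspan⟩ := hfg
    refine ⟨S.card, fun k => (S.equivFin.symm k : Fin r → MvPolynomial σ K),
      fun k => hS (S.equivFin.symm k).2, ?_⟩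
    rw [← hZ.span_eq deg, hspan]
    congr 1
    ext z
    constructor
    · rintro ⟨k, rfl⟩
      exact (S.equivFin.symm k).2
    · intro hz
      exact ⟨S.equivFin ⟨z, hz⟩, by simp⟩
  obtain ⟨g, hg, hspan⟩ := Nat.find_spec hQ
  have hmin : ∀ s, s < Nat.find hQ → ¬ Q s := fun s hs => Nat.find_min hQ hs
  generalize Nat.find hQ = s at g hg hspan hmin
  choose hgZ deg' hdeg using hg
  let d := Fintype.linearCombination (MvPolynomial σ K) g
  have hd : ∀ u, d u = ∑ k, u k • g k := fun u => Fintype.linearCombination_apply _ _ _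
  have hcomp : ∀ a u, d (gradedComponent deg' a u) = gradedComponent deg a (d u) := by
    intro a u
    rw [hd, hd, map_sum]
    refine Finset.sum_congr rfl fun k _ => ?_
    rw [gradedComponent_smul deg a (u k) (hdeg k)]
    rfl
  refine ⟨s, deg', d, ?_, ?_, ?_, ?_⟩
  · rw [Fintype.range_linearCombination, hspan]
  · intro k
    have : d (Pi.single k 1) = g k := by
      simp [d, Fintype.linearCombination_apply_single]
    rw [this]
    exact hdeg k
  · intro u hu k
    rw [mem_span_range_X_iff]
    by_contra hc
    obtain ⟨t, rfl⟩ : ∃ t, s = t + 1 := Nat.exists_eq_succ_of_ne_zero (by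
      rintro rfl
      exact k.elim0)
    -- In degree `deg' k` the relation has the nonzero constant term of `u k` as its `k`-th
    -- coefficient. Solving for `g k` makes this generator superfluous.
    have h1 := hcomp (deg' k) u
    rw [hu, map_zero, hd, Fin.sum_univ_succAbove _ k] at h1
    have h2 : gradedComponent deg' (deg' k) u k = C (coeff 0 (u k)) := by
      change shiftedComponent (deg' k) (deg' k) (u k) = _
      rw [shiftedComponent_of_le le_rfl, tsub_self]
      rfl
    rw [h2] at h1
    set Z' := Submodule.span (MvPolynomial σ K) (Set.range fun j => g (k.succAbove j)) with hZ'
    have h3 : (C (coeff 0 (u k)) : MvPolynomial σ K) • g k ∈ Z' := by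
      rw [eq_neg_of_add_eq_zero_left h1]
      exact neg_mem (Submodule.sum_mem _ fun j _ => Submodule.smul_mem _ _
        (Submodule.subset_span ⟨j, rfl⟩))
    have h4 : g k ∈ Z' := by
      have := Submodule.smul_mem Z' (C (coeff 0 (u k))⁻¹ : MvPolynomial σ K) h3
      rwa [smul_smul, ← C_mul, inv_mul_cancel₀ hc, C_1, one_smul] at this
    refine hmin t (Nat.lt_succ_self t) ⟨fun j => g (k.succAbove j),
      fun j => ⟨hgZ _, _, hdeg _⟩, ?_⟩
    rw [← hspan]
    apply le_antisymm
    · exact Submodule.span_mono (by rintro _ ⟨j, rfl⟩; exact ⟨_, rfl⟩)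
    · rw [Submodule.span_le]
      rintro _ ⟨j, rfl⟩
      rcases Fin.eq_self_or_eq_succAbove k j with rfl | ⟨j, rfl⟩
      · exact h4
      · exact Submodule.subset_span ⟨j, rfl⟩
  · intro a u hu
    rw [LinearMap.mem_ker] at hu ⊢
    rw [hcomp, hu, map_zero]

variable (σ K) in
/-- A graded submodule of a multigraded free module of finite rank. -/
structure GradedSub where
  /-- The rank of the free module. -/
  rank : ℕ
  /-- The degrees of the basis vectors. -/
  degree : Fin rank → σ →₀ ℕ
  /-- The submodule. -/
  sub : Submodule (MvPolynomial σ K) (Fin rank → MvPolynomial σ K)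
  /-- The submodule is graded. -/
  graded : IsGradedSubmodule degree sub

namespace GradedSub

variable [Finite σ] (Z : GradedSub σ K)

/-- The relations between minimal homogeneous generators of a graded submodule. -/
noncomputable def next : GradedSub σ K where
  rank := (Z.graded.exists_cover Z.degree).choose
  degree := (Z.graded.exists_cover Z.degree).choose_spec.choose
  sub := LinearMap.ker (Z.graded.exists_cover Z.degree).choose_spec.choose_spec.choose
  graded := (Z.graded.exists_cover Z.degree).choose_spec.choose_spec.choose_spec.2.2.2

/-- The map defined by minimal homogeneous generators of a graded submodule. -/
noncomputable def map : (Fin Z.next.rank → MvPolynomial σ K) →ₗ[MvPolynomial σ K]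
    (Fin Z.rank → MvPolynomial σ K) :=
  (Z.graded.exists_cover Z.degree).choose_spec.choose_spec.choose

lemma range_map : LinearMap.range Z.map = Z.sub :=
  (Z.graded.exists_cover Z.degree).choose_spec.choose_spec.choose_spec.1

lemma map_homogeneous (k : Fin Z.next.rank) :
    IsGradedHomogeneous Z.degree (Z.next.degree k) (Z.map (Pi.single k 1)) :=
  (Z.graded.exists_cover Z.degree).choose_spec.choose_spec.choose_spec.2.1 k

lemma exact_map : Function.Exact Z.next.map Z.map := by
  intro u
  rw [← LinearMap.mem_ker]
  exact iff_of_eq (congrArg (u ∈ ·) Z.next.range_map.symm)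

lemma mem_of_mem_next_sub {u : Fin Z.next.rank → MvPolynomial σ K} (hu : u ∈ Z.next.sub)
    (k : Fin Z.next.rank) : u k ∈ Ideal.span (Set.range (X : σ → MvPolynomial σ K)) :=
  (Z.graded.exists_cover Z.degree).choose_spec.choose_spec.choose_spec.2.2.1 u hu k

/-- The iterated relations. -/
noncomputable def iter : ℕ → GradedSub σ K
  | 0 => Z.next
  | i + 1 => (iter i).next

lemma mem_of_mem_iter_sub (i : ℕ) {u : Fin (Z.iter i).rank → MvPolynomial σ K}
    (hu : u ∈ (Z.iter i).sub) (k : Fin (Z.iter i).rank) :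
    u k ∈ Ideal.span (Set.range (X : σ → MvPolynomial σ K)) := by
  cases i with
  | zero => exact Z.mem_of_mem_next_sub hu k
  | succ i => exact (Z.iter i).mem_of_mem_next_sub hu k

end GradedSub

end MvPolynomial

/-- Every monomial ideal in finitely many variables has a minimal multigraded free resolution. -/
lemma nonempty_minimalMultigradedResolution {σ : Type u} {K : Type v} [Field K] [Finite σ]
    (I : Ideal (MvPolynomial σ K))
    (hI : ∀ p ∈ I, ∀ m, monomial m (coeff m p) ∈ I) :
    Nonempty (MinimalMultigradedResolution I) := by
  let e : (Fin 1 → MvPolynomial σ K) →ₗ[MvPolynomial σ K] MvPolynomial σ K := LinearMap.proj 0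
  -- The ideal is a graded submodule of `A(0)`. Since `iter` starts at `Z.next`, the ambient ring
  -- itself is not part of the resolution, and no minimality is asked of the augmentation.
  let Z : GradedSub σ K :=
    { rank := 1
      degree := fun _ => 0
      sub := Submodule.comap e I
      graded := by
        intro a z hz
        change shiftedComponent 0 a (z 0) ∈ I
        rw [shiftedComponent_of_le zero_le]
        exact hI _ hz _ }
  have he : Function.Injective e := by
    intro a b h
    ext1 l
    rw [Subsingleton.elim l 0]
    exact h
  have hes : Function.Surjective e := fun p => ⟨fun _ => p, rfl⟩
  refine ⟨{
    rank := fun i => (Z.iter i).rank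
    degree := fun i => (Z.iter i).degree
    aug := e.comp Z.map
    diff := fun i => (Z.iter i).map
    range_aug := ?_
    exact_aug := ?_
    exact_diff := ?_
    aug_homogeneous := ?_
    diff_homogeneous := ?_
    minimal := ?_ }⟩
  · apply le_antisymm
    · rintro _ ⟨u, rfl⟩
      exact Z.range_map.le ⟨u, rfl⟩
    · intro p hp
      obtain ⟨z, rfl⟩ := hes p
      obtain ⟨u, hu⟩ := Z.range_map.ge (show z ∈ Z.sub from hp)
      exact ⟨u, congrArg e hu⟩
  · intro u
    refine Iff.trans ?_ (Z.exact_map u)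
    exact map_eq_zero_iff e he
  · exact fun i => (Z.iter i).exact_map
  · intro k m hm
    exact (add_zero m).symm.trans (Z.map_homogeneous k 0 m hm)
  · intro i k l m hm
    exact (Z.iter i).map_homogeneous k l m hm
  · intro i k l
    exact Z.mem_of_mem_iter_sub i ((Z.iter i).range_map.le ⟨_, rfl⟩) l

lemma SpernerHypergraph.nonempty_resolution {V : Type u} [Finite V] (K : Type v) [Field K]
    (H : SpernerHypergraph V) : Nonempty (MinimalMultigradedResolution (H.edgeIdeal K)) := by
  classical
  refine nonempty_minimalMultigradedResolution _ fun p hp m => ?_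
  rw [mem_edgeIdeal_iff] at hp ⊢
  intro m' hm'
  have h1 := Finset.mem_singleton.1 (support_monomial_subset hm')
  subst h1
  refine hp m' ?_
  rw [mem_support_iff, coeff_monomial, if_pos rfl] at hm'
  exact mem_support_iff.2 hm'

end

/-! ### `Ext` from the residue field and the Auslander–Buchsbaum formula -/

section

open MvPolynomial CategoryTheory Abelian

namespace MinimalMultigradedResolution

variable {σ : Type u} {K : Type v} [Field K]

/-- Scalars act equally well through the first argument, where `r` is zero. -/
lemma smul_ext_residueModule {M : ModuleCat.{max u v} (MvPolynomial σ K)} {n : ℕ}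
    (α : Ext (residueModule σ K) M n) {r : MvPolynomial σ K}
    (hr : r ∈ Ideal.span (Set.range (X : σ → MvPolynomial σ K))) : r • α = 0 := by
  have h0 : r • 𝟙 (residueModule σ K) = 0 := by
    refine ModuleCat.hom_ext (LinearMap.ext fun x => ?_)
    obtain ⟨y, rfl⟩ := Submodule.Quotient.mk_surjective _ x
    change (Submodule.Quotient.mk (r • y) :
      MvPolynomial σ K ⧸ Ideal.span (Set.range (X : σ → MvPolynomial σ K))) = 0
    rw [Submodule.Quotient.mk_eq_zero]
    exact Ideal.mul_mem_right _ _ hr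
  rw [← Ext.mk₀_id_comp α, ← Ext.smul_comp, ← Ext.mk₀_smul, h0, Ext.mk₀_zero, Ext.zero_comp]

lemma subsingleton_ext_of_retract {N M M' : ModuleCat.{max u v} (MvPolynomial σ K)} {n : ℕ}
    (f : M ⟶ M') (g : M' ⟶ M) (h : f ≫ g = 𝟙 M) (hM : Subsingleton (Ext N M' n)) :
    Subsingleton (Ext N M n) := by
  refine ⟨fun α β => ?_⟩
  have key : ∀ α : Ext N M n, α = (α.comp (Ext.mk₀ f) (add_zero n)).comp (Ext.mk₀ g)
      (add_zero n) := fun α => by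
    rw [Ext.comp_assoc_of_second_deg_zero, Ext.mk₀_comp_mk₀, h, Ext.comp_mk₀_id]
  rw [key α, key β, Subsingleton.elim (α.comp (Ext.mk₀ f) (add_zero n))]

/-- The elementary maps between free modules. -/
noncomputable def elementaryMap {r s : ℕ} (k : Fin r) (l : Fin s) :
    (Fin r → MvPolynomial σ K) →ₗ[MvPolynomial σ K] (Fin s → MvPolynomial σ K) :=
  (LinearMap.single _ _ l).comp (LinearMap.proj k)

lemma sum_elementaryMap {r s : ℕ}
    (g : (Fin r → MvPolynomial σ K) →ₗ[MvPolynomial σ K] (Fin s → MvPolynomial σ K)) :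
    g = ∑ k, ∑ l, g (Pi.single k 1) l • elementaryMap k l := by
  refine LinearMap.pi_ext' fun k => LinearMap.ext_ring ?_
  ext1 l
  simp only [LinearMap.comp_apply, LinearMap.sum_apply, LinearMap.smul_apply, Finset.sum_apply,
    elementaryMap, LinearMap.proj_apply, LinearMap.single_apply, Pi.smul_apply]
  rw [Finset.sum_eq_single k, Finset.sum_eq_single l]
  · simp
  · intro l' _ hl'
    simp [Pi.single_eq_of_ne hl'.symm]
  · simp
  · intro k' _ hk'
    refine Finset.sum_eq_zero fun l' _ => ?_
    simp [Pi.single_eq_of_ne hk']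
  · simp

lemma ext_comp_eq_sum {N : ModuleCat.{max u v} (MvPolynomial σ K)} {n r s : ℕ}
    (g : (Fin r → MvPolynomial σ K) →ₗ[MvPolynomial σ K] (Fin s → MvPolynomial σ K))
    (α : Ext N (ModuleCat.of (MvPolynomial σ K) (Fin r → MvPolynomial σ K)) n) :
    α.comp (Ext.mk₀ (ModuleCat.ofHom g)) (add_zero n) =
      ∑ k, ∑ l, g (Pi.single k 1) l •
        α.comp (Ext.mk₀ (ModuleCat.ofHom (elementaryMap k l))) (add_zero n) := by
  have h : ModuleCat.ofHom g = ∑ k, ∑ l, g (Pi.single k 1) l •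
      ModuleCat.ofHom (elementaryMap (σ := σ) (K := K) k l) := by
    apply ModuleCat.hom_ext
    rw [ModuleCat.hom_sum]
    simp only [ModuleCat.hom_sum, ModuleCat.hom_smul, ModuleCat.hom_ofHom]
    exact sum_elementaryMap g
  rw [h]
  simp only [Ext.mk₀_sum, Ext.mk₀_smul, Ext.comp_sum, Ext.comp_smul]

/-- A map of free modules with entries in the ideal of the variables is zero on `Ext` groups of
the residue field. -/
lemma ext_comp_eq_zero {n r s : ℕ}
    (g : (Fin r → MvPolynomial σ K) →ₗ[MvPolynomial σ K] (Fin s → MvPolynomial σ K))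
    (hg : ∀ k l, g (Pi.single k 1) l ∈ Ideal.span (Set.range (X : σ → MvPolynomial σ K)))
    (α : Ext (residueModule σ K) (ModuleCat.of (MvPolynomial σ K) (Fin r → MvPolynomial σ K)) n) :
    α.comp (Ext.mk₀ (ModuleCat.ofHom g)) (add_zero n) = 0 := by
  rw [ext_comp_eq_sum]
  exact Finset.sum_eq_zero fun k _ => Finset.sum_eq_zero fun l _ =>
    smul_ext_residueModule _ (hg k l)

lemma subsingleton_ext_pi {N : ModuleCat.{max u v} (MvPolynomial σ K)} {n : ℕ} (r : ℕ)
    (h : Subsingleton (Ext N (ModuleCat.of (MvPolynomial σ K) (MvPolynomial σ K)) n)) :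
    Subsingleton (Ext N (ModuleCat.of (MvPolynomial σ K) (Fin r → MvPolynomial σ K)) n) := by
  refine subsingleton_of_forall_eq 0 fun α => ?_
  rw [← Ext.comp_mk₀_id α, ← ModuleCat.ofHom_id, ext_comp_eq_sum]
  refine Finset.sum_eq_zero fun k _ => Finset.sum_eq_zero fun l _ => ?_
  have : ModuleCat.ofHom (elementaryMap (σ := σ) (K := K) k l) =
      ModuleCat.ofHom (LinearMap.proj k) ≫ ModuleCat.ofHom
        (LinearMap.single (MvPolynomial σ K) (fun _ => MvPolynomial σ K) l) := rfl
  rw [this, ← Ext.mk₀_comp_mk₀, ← Ext.comp_assoc_of_second_deg_zero,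
    Subsingleton.elim (α.comp (Ext.mk₀ (ModuleCat.ofHom (LinearMap.proj k))) (add_zero n)) 0,
    Ext.zero_comp, smul_zero]

/-! ### The depth of the polynomial ring -/

/-- The quotient of the polynomial ring by the variables in `T`. -/
noncomputable abbrev quotientVars (K : Type v) [Field K] (T : Finset σ) :
    ModuleCat.{max u v} (MvPolynomial σ K) :=
  ModuleCat.of _ (MvPolynomial σ K ⧸ Ideal.span (X '' (T : Set σ) : Set (MvPolynomial σ K)))

lemma injective_smul_quotientVars (T : Finset σ) (s : σ) (hs : s ∉ T) : Function.Injective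
    ((X s : MvPolynomial σ K) • (LinearMap.id : quotientVars K T →ₗ[MvPolynomial σ K] quotientVars K T)) := by
  rw [injective_iff_map_eq_zero]
  intro x hx
  obtain ⟨a, rfl⟩ := Submodule.Quotient.mk_surjective _ x
  rw [LinearMap.smul_apply, LinearMap.id_apply, ← Submodule.Quotient.mk_smul,
    Submodule.Quotient.mk_eq_zero, smul_eq_mul, mem_ideal_span_X_image] at hx
  rw [Submodule.Quotient.mk_eq_zero, mem_ideal_span_X_image]
  intro m hm
  obtain ⟨i, hi, him⟩ := hx (Finsupp.single s 1 + m) (by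
    rw [mem_support_iff, coeff_X_mul]
    exact mem_support_iff.1 hm)
  refine ⟨i, hi, ?_⟩
  have : s ≠ i := by
    rintro rfl
    exact hs hi
  simpa [Finsupp.single_apply, this] using him

section

variable [DecidableEq σ] (T : Finset σ) (s : σ)

lemma span_X_image_le : Ideal.span (X '' (T : Set σ) : Set (MvPolynomial σ K)) ≤
    Ideal.span (X '' (insert s T : Finset σ) : Set (MvPolynomial σ K)) :=
  Ideal.span_mono (Set.image_mono (Finset.coe_subset.2 (Finset.subset_insert _ _)))

lemma exact_quotientVars : Function.Exact
    ((X s : MvPolynomial σ K) • (LinearMap.id : quotientVars K T →ₗ[MvPolynomial σ K] quotientVars K T))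
    (Submodule.factor (span_X_image_le (K := K) T s)) := by
  intro x
  obtain ⟨a, rfl⟩ := Submodule.Quotient.mk_surjective _ x
  change (Submodule.Quotient.mk a : MvPolynomial σ K ⧸
    Ideal.span (X '' (insert s T : Finset σ) : Set (MvPolynomial σ K))) = 0 ↔ _
  rw [Submodule.Quotient.mk_eq_zero, Finset.coe_insert, Set.image_insert_eq,
    Ideal.mem_span_insert]
  constructor
  · rintro ⟨c, z, hz, rfl⟩
    refine ⟨Submodule.Quotient.mk c, ?_⟩
    rw [LinearMap.smul_apply, LinearMap.id_apply, ← Submodule.Quotient.mk_smul,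
      Submodule.Quotient.eq, smul_eq_mul, mul_comm, sub_add_cancel_left]
    exact neg_mem hz
  · rintro ⟨y, hy⟩
    obtain ⟨c, rfl⟩ := Submodule.Quotient.mk_surjective _ y
    rw [LinearMap.smul_apply, LinearMap.id_apply, ← Submodule.Quotient.mk_smul, eq_comm,
      Submodule.Quotient.eq, smul_eq_mul] at hy
    exact ⟨c, _, hy, by ring⟩

/-- Multiplication by a new variable on the quotient by some variables. -/
noncomputable abbrev quotientVarsComplex :
    ShortComplex (ModuleCat.{max u v} (MvPolynomial σ K)) :=
  ModuleCat.shortComplexOfCompEqZero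
    ((X s : MvPolynomial σ K) • (LinearMap.id : quotientVars K T →ₗ[MvPolynomial σ K] quotientVars K T))
    (Submodule.factor (span_X_image_le (K := K) T s))
    (exact_quotientVars T s).linearMap_comp_eq_zero

lemma quotientVarsComplex_shortExact (hs : s ∉ T) :
    (quotientVarsComplex (K := K) T s).ShortExact :=
  ModuleCat.shortComplex_shortExact _ (exact_quotientVars T s)
    (injective_smul_quotientVars T s hs) (Submodule.factor_surjective (span_X_image_le T s))

lemma comp_quotientVarsComplex_f {n : ℕ} (α : Ext (residueModule σ K) (quotientVars K T) n) :
    Ext.comp (Y := (quotientVarsComplex (K := K) T s).X₁) α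
      (Ext.mk₀ (quotientVarsComplex (K := K) T s).f) (add_zero n) = 0 := by
  have : (quotientVarsComplex (K := K) T s).f = (X s : MvPolynomial σ K) • 𝟙 (quotientVars K T) := rfl
  rw [this, ← Ext.smul_eq_comp_mk₀]
  exact smul_ext_residueModule _ (Ideal.subset_span ⟨s, rfl⟩)

end

/-- Killing variables one at a time: multiplication by a new variable is injective on the quotient
but zero on `Ext` from the residue module, so the first nonzero `Ext` moves by one. With no variable
left, the quotient is the residue module, whose identity is nonzero. -/
lemma ext_quotientVars [Finite σ] (q : ℕ) (T : Finset σ) (hT : T.card + q = Nat.card σ) :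
    (∀ i, i < q → Subsingleton (Ext (residueModule σ K) (quotientVars K T) i)) ∧
      ¬ Subsingleton (Ext (residueModule σ K) (quotientVars K T) q) := by
  classical
  have := Fintype.ofFinite σ
  rw [Nat.card_eq_fintype_card] at hT
  induction q generalizing T with
  | zero =>
    refine ⟨fun i hi => absurd hi (Nat.not_lt_zero i), fun h => ?_⟩
    obtain rfl : T = Finset.univ := Finset.card_eq_iff_eq_univ T |>.1 (by simpa using hT)
    have h1 : (Ideal.span (X '' ((Finset.univ : Finset σ) : Set σ) : Set (MvPolynomial σ K))) =
        Ideal.span (Set.range (X : σ → MvPolynomial σ K)) := by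
      rw [Finset.coe_univ, Set.image_univ]
    have h2 : Subsingleton (residueModule σ K ⟶ quotientVars K (Finset.univ : Finset σ)) :=
      Ext.homEquiv₀.symm.subsingleton
    have h3 := Subsingleton.elim (ModuleCat.ofHom (Submodule.factor h1.ge) :
      residueModule σ K ⟶ quotientVars K (Finset.univ : Finset σ)) 0
    have h4 := ConcreteCategory.congr_hom h3 (Submodule.Quotient.mk 1)
    change (Submodule.Quotient.mk (1 : MvPolynomial σ K) : MvPolynomial σ K ⧸
      Ideal.span (X '' ((Finset.univ : Finset σ) : Set σ) : Set (MvPolynomial σ K))) = 0 at h4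
    rw [Submodule.Quotient.mk_eq_zero, h1, ← Ideal.eq_top_iff_one] at h4
    exact span_range_X_ne_top h4
  | succ q ih =>
    obtain ⟨s, hs⟩ : ∃ s, s ∉ T := by
      by_contra! h
      have := Finset.card_eq_iff_eq_univ T |>.2 (Finset.eq_univ_iff_forall.2 h)
      omega
    obtain ⟨h1, h2⟩ := ih (insert s T) (by
      rw [Finset.card_insert_of_notMem hs]
      omega)
    have hS := quotientVarsComplex_shortExact (K := K) T s hs
    have h3 : ∀ i, i < q + 1 → Subsingleton (Ext (residueModule σ K) (quotientVars K T) i) := by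
      intro i hi
      refine subsingleton_of_forall_eq 0 fun α => ?_
      have hα := comp_quotientVarsComplex_f T s α
      cases i with
      | zero =>
        have := hS.mono_f
        exact (injective_iff_map_eq_zero _).1 (Ext.postcomp_mk₀_injective_of_mono
          (residueModule σ K) (quotientVarsComplex (K := K) T s).f) α hα
      | succ i =>
        obtain ⟨β, rfl⟩ := Ext.covariant_sequence_exact₁ _ hS α hα rfl
        have := h1 i (by omega)
        rw [Subsingleton.elim β 0, Ext.zero_comp]
    refine ⟨h3, fun h => h2 (subsingleton_of_forall_eq 0 fun α => ?_)⟩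
    obtain ⟨β, rfl⟩ := Ext.covariant_sequence_exact₃ _ hS α rfl (Subsingleton.elim (h := h) _ _)
    have : β = 0 := Subsingleton.elim (h := h3 q (Nat.lt_succ_self q)) _ _
    rw [this, Ext.zero_comp]

lemma ext_polynomialRing [Finite σ] :
    (∀ i, i < Nat.card σ → Subsingleton (Ext (residueModule σ K)
        (ModuleCat.of (MvPolynomial σ K) (MvPolynomial σ K)) i)) ∧
      ¬ Subsingleton (Ext (residueModule σ K)
        (ModuleCat.of (MvPolynomial σ K) (MvPolynomial σ K)) (Nat.card σ)) := by
  obtain ⟨h1, h2⟩ := ext_quotientVars (K := K) (Nat.card σ) (∅ : Finset σ) (by simp)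
  have hbot : Ideal.span (X '' ((∅ : Finset σ) : Set σ) : Set (MvPolynomial σ K)) = ⊥ := by
    simp
  let e : (ModuleCat.of (MvPolynomial σ K) (MvPolynomial σ K)) ≅ quotientVars K (∅ : Finset σ) :=
    (Submodule.quotEquivOfEqBot _ hbot).symm.toModuleIso
  exact ⟨fun i hi => subsingleton_ext_of_retract e.hom e.inv e.hom_inv_id (h1 i hi),
    fun h => h2 (subsingleton_ext_of_retract e.inv e.hom e.inv_hom_id h)⟩

/-! ### The depth of an ideal -/

variable {I : Ideal (MvPolynomial σ K)} (R : MinimalMultigradedResolution I)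

lemma exists_inverse_cover {p : ℕ} (hp : R.rank (p + 1) = 0) :
    ∃ g : R.syzygy p →ₗ[MvPolynomial σ K] (Fin (R.rank p) → MvPolynomial σ K),
      (R.cover p).comp g = LinearMap.id ∧ g.comp (R.cover p) = LinearMap.id := by
  have hinj : Function.Injective (R.cover p) := by
    rw [injective_iff_map_eq_zero]
    intro x hx
    obtain ⟨u, rfl⟩ := (R.cover_eq_zero_iff p x).1 hx
    have : IsEmpty (Fin (R.rank (p + 1))) := by
      rw [hp]
      infer_instance
    rw [Subsingleton.elim u 0, map_zero]
  let e := LinearEquiv.ofBijective (R.cover p) ⟨hinj, R.cover_surjective p⟩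
  exact ⟨e.symm.toLinearMap, LinearMap.ext e.apply_symm_apply, LinearMap.ext e.symm_apply_apply⟩

/-- Descent from the last syzygy module, which is free and nonzero and so has its first nonzero
`Ext` at the number of variables. Each step down the resolution lowers that index by one. -/
lemma ext_syzygy [Finite σ] {p : ℕ} (hp : R.rank p ≠ 0) (hp' : R.rank (p + 1) = 0) (q i : ℕ)
    (hi : i + q = p) :
    (∀ t, t + q < Nat.card σ → Subsingleton (Ext (residueModule σ K) (R.syzygy i) t)) ∧
      ∀ t, t + q = Nat.card σ → ¬ Subsingleton (Ext (residueModule σ K) (R.syzygy i) t) := by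
  obtain ⟨hA, hA'⟩ := ext_polynomialRing (σ := σ) (K := K)
  obtain ⟨g, hg, hg'⟩ := R.exists_inverse_cover hp'
  induction q generalizing i with
  | zero =>
    obtain rfl : i = p := by simpa using hi
    refine ⟨fun t ht => ?_, fun t ht h => hA' ?_⟩
    · exact subsingleton_ext_of_retract (M := R.syzygy i) (M' := R.freeModule i)
        (ModuleCat.ofHom g) (ModuleCat.ofHom (R.cover i))
        (ModuleCat.hom_ext hg) (subsingleton_ext_pi _ (hA t ht))
    · obtain rfl : t = Nat.card σ := by simpa using ht
      have h1 := subsingleton_ext_of_retract (M := R.freeModule i) (M' := R.syzygy i)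
        (ModuleCat.ofHom (R.cover i)) (ModuleCat.ofHom g) (ModuleCat.hom_ext hg') h
      let k : Fin (R.rank i) := ⟨0, Nat.pos_of_ne_zero hp⟩
      let a : ModuleCat.of (MvPolynomial σ K) (MvPolynomial σ K) ⟶ R.freeModule i :=
        ModuleCat.ofHom (LinearMap.single (MvPolynomial σ K) (fun _ => MvPolynomial σ K) k)
      let b : R.freeModule i ⟶ ModuleCat.of (MvPolynomial σ K) (MvPolynomial σ K) :=
        ModuleCat.ofHom (LinearMap.proj k)
      refine subsingleton_ext_of_retract a b (ModuleCat.hom_ext ?_) h1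
      exact LinearMap.proj_comp_single_same (MvPolynomial σ K) (fun _ => MvPolynomial σ K) k
  | succ q ih =>
    obtain ⟨h1, h2⟩ := ih (i + 1) (by omega)
    have hS := R.syzygyComplex_shortExact i
    have hF : ∀ t, t < Nat.card σ → Subsingleton (Ext (residueModule σ K) (R.freeModule i) t) :=
      fun t ht => subsingleton_ext_pi _ (hA t ht)
    refine ⟨fun t ht => subsingleton_of_forall_eq 0 fun α => ?_,
      fun t ht h => h2 (t + 1) (by omega) (subsingleton_of_forall_eq 0 fun α => ?_)⟩
    · obtain ⟨β, rfl⟩ := Ext.covariant_sequence_exact₃ _ hS α rfl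
        (Subsingleton.elim (h := h1 (t + 1) (by omega)) _ _)
      have : β = 0 := Subsingleton.elim (h := hF t (by omega)) _ _
      rw [this, Ext.zero_comp]
    · have hα : Ext.comp (Y := (R.syzygyComplex i).X₁) α (Ext.mk₀ (R.syzygyComplex i).f)
          (add_zero (t + 1)) = 0 := by
        by_cases htn : t + 1 < Nat.card σ
        · exact Subsingleton.elim (h := hF (t + 1) htn) _ _
        -- Borderline case: `Ext` of `F i` need not vanish in this degree. But the syzygy module
        -- here is the last one, so it is free, and its inclusion is a matrix with entries in the
        -- ideal of the variables, hence zero on `Ext`.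
        · obtain rfl : p = i + 1 := by omega
          let c : R.freeModule (i + 1) ⟶ R.syzygy (i + 1) := ModuleCat.ofHom (R.cover (i + 1))
          let c' : R.syzygy (i + 1) ⟶ R.freeModule (i + 1) := ModuleCat.ofHom g
          let j : R.syzygy (i + 1) ⟶ R.freeModule i := (R.syzygyComplex i).f
          have hid : c' ≫ c = 𝟙 (R.syzygy (i + 1)) := ModuleCat.hom_ext hg
          have hdiff : c ≫ j = ModuleCat.ofHom (R.diff i) := rfl
          change Ext.comp (Y := R.syzygy (i + 1)) α (Ext.mk₀ j) (add_zero (t + 1)) = 0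
          rw [← Ext.comp_mk₀_id α, ← hid, ← Ext.mk₀_comp_mk₀,
            ← Ext.comp_assoc_of_second_deg_zero, Ext.comp_assoc_of_second_deg_zero,
            Ext.mk₀_comp_mk₀, hdiff]
          exact ext_comp_eq_zero _ (R.minimal i) _
      obtain ⟨β, rfl⟩ := Ext.covariant_sequence_exact₁ _ hS α hα rfl
      have : β = 0 := Subsingleton.elim (h := h) _ _
      rw [this, Ext.zero_comp]
      rfl

/-- Nakayama in its determinant form: equality would give an annihilator of `I` congruent to 1, and
it must be 0 because the ring is a domain. -/
lemma smul_top_lt_top [Finite σ] (hI : I ≠ ⊥) :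
    Ideal.span (Set.range (X : σ → MvPolynomial σ K)) • (⊤ : Submodule (MvPolynomial σ K) I) < ⊤ := by
  rw [lt_top_iff_ne_top]
  intro h
  obtain ⟨r, hr, hr0⟩ := Submodule.exists_sub_one_mem_and_smul_eq_zero_of_fg_of_le_smul
    (Ideal.span (Set.range (X : σ → MvPolynomial σ K))) (⊤ : Submodule (MvPolynomial σ K) I)
    (IsNoetherian.noetherian _) h.ge
  obtain ⟨x, hx, hx0⟩ := Submodule.exists_mem_ne_zero_of_ne_bot hI
  have h1 := congrArg Subtype.val (hr0 ⟨x, hx⟩ trivial)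
  have h2 : r = 0 := (mul_eq_zero.1 h1).resolve_right hx0
  rw [h2, zero_sub, neg_mem_iff, ← Ideal.eq_top_iff_one] at hr
  exact span_range_X_ne_top hr

lemma ideal_eq_bot_iff : I = ⊥ ↔ R.rank 0 = 0 := by
  constructor
  · intro h
    by_contra h0
    let k : Fin (R.rank 0) := ⟨0, Nat.pos_of_ne_zero h0⟩
    have h1 : R.aug (Pi.single k 1) = 0 := by
      have : R.aug (Pi.single k 1) ∈ I := R.range_aug.le ⟨_, rfl⟩
      simpa [h] using this
    obtain ⟨u, hu⟩ := (R.exact_aug _).1 h1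
    have := R.diff_apply_mem 0 u k
    rw [hu, mem_span_range_X_iff] at this
    simp at this
  · intro h
    have : IsEmpty (Fin (R.rank 0)) := by
      rw [h]
      infer_instance
    rw [eq_bot_iff]
    intro p hp
    obtain ⟨u, rfl⟩ := R.range_aug.ge hp
    rw [Subsingleton.elim u 0, map_zero]
    exact zero_mem _

/-- The Auslander–Buchsbaum formula for an ideal with a finite minimal resolution. -/
lemma idealDepth_eq [Finite σ] {p : ℕ} (hp : R.rank p ≠ 0) (hp' : R.rank (p + 1) = 0)
    (hpn : p ≤ Nat.card σ) (hI : I ≠ ⊥) : idealDepth I = ((Nat.card σ - p : ℕ) : ℕ∞) := by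
  obtain ⟨h1, h2⟩ := R.ext_syzygy hp hp' p 0 (zero_add p)
  -- Rees: regular sequences of length `d` in the ideal of the variables exist exactly when `Ext`
  -- from the residue module vanishes below `d`.
  have htfae := fun d => ModuleCat.exists_isRegular_tfae
    (Ideal.span (Set.range (X : σ → MvPolynomial σ K))) d
    (ModuleCat.of (MvPolynomial σ K) I) (smul_top_lt_top hI)
  have hsupp : Module.support (MvPolynomial σ K) (residueModule σ K) = PrimeSpectrum.zeroLocus
      (Ideal.span (Set.range (X : σ → MvPolynomial σ K)) : Set (MvPolynomial σ K)) := by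
    rw [Module.support_eq_zeroLocus, Ideal.annihilator_quotient]
  apply le_antisymm
  · refine sSup_le ?_
    rintro _ ⟨rs, hrs, hreg, rfl⟩
    by_contra! hlt
    rw [Nat.cast_lt] at hlt
    refine h2 (Nat.card σ - p) (by omega) ?_
    have h30 := (htfae rs.length).out 3 0
    exact h30.1 ⟨rs, rfl, hrs, hreg⟩ (residueModule σ K)
      (inferInstanceAs (Nontrivial (MvPolynomial σ K ⧸ _))) inferInstance hsupp.le _ hlt
  · have h23 := (htfae (Nat.card σ - p)).out 2 3
    obtain ⟨rs, hlen, hrs, hreg⟩ := h23.1 ⟨residueModule σ K,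
      inferInstanceAs (Nontrivial (MvPolynomial σ K ⧸ _)), inferInstance, hsupp,
      fun i hi => h1 i (by omega)⟩
    exact le_sSup ⟨rs, hrs, hreg, by rw [hlen]⟩

end MinimalMultigradedResolution

end

/-! ### Transfer of Betti tables through the deck -/

section

open MvPolynomial

namespace MinimalMultigradedResolution

section Uniqueness

variable {U : Type u} {K : Type v} [Field K] {J : Ideal (MvPolynomial U K)}
  (R R' : MinimalMultigradedResolution J)

/-- Both counts are ranks of minimal resolutions of the same ideal, obtained by restriction to the
variables in `S`. -/
lemma card_support_subset (i : ℕ) (S : Finset U) :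
    Nat.card {k // (R.degree i k).support ⊆ S} = Nat.card {k // (R'.degree i k).support ⊆ S} := by
  have hf : Function.Injective (Subtype.val : {x // x ∈ S} → U) := Subtype.val_injective
  have h := (R.restrict hf _ rfl).rank_eq_rank (R'.restrict hf _ rfl) i
  have hover : ∀ (R : MinimalMultigradedResolution J) k,
      R.Over (Subtype.val : {x // x ∈ S} → U) i k ↔ (R.degree i k).support ⊆ S := by
    intro R k
    rw [Over, Subtype.range_coe, ← Finset.coe_subset]
  change Nat.card {k // R.Over _ i k} = Nat.card {k // R'.Over _ i k} at h
  simpa only [hover] using h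

lemma card_support_eq (i : ℕ) (S : Finset U) :
    Nat.card {k // (R.degree i k).support = S} = Nat.card {k // (R'.degree i k).support = S} := by
  classical
  have key : ∀ (R : MinimalMultigradedResolution J) (S : Finset U),
      Nat.card {k // (R.degree i k).support ⊆ S} = Nat.card {k // (R.degree i k).support = S} +
        ∑ T ∈ S.ssubsets, Nat.card {k // (R.degree i k).support = T} := by
    intro R S
    simp only [Nat.card_eq_fintype_card, Fintype.card_subtype]
    rw [Finset.card_eq_sum_card_fiberwise (f := fun k => (R.degree i k).support) (t := S.powerset)
      (fun k hk => by simpa using hk), ← Finset.sum_insert_of_eq_zero_if_notMem (a := S)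
      (s := S.powerset) (by simp), Finset.ssubsets, Finset.insert_eq_of_mem (by simp),
      ← Finset.add_sum_erase _ _ (Finset.mem_powerset_self S)]
    congr 1
    · congr 1
      ext k
      simp only [Finset.mem_filter, Finset.mem_univ, true_and, and_iff_right_iff_imp]
      exact fun h => h.le
    · refine Finset.sum_congr rfl fun T hT => ?_
      congr 1
      ext k
      simp only [Finset.mem_filter, Finset.mem_univ, true_and, and_iff_right_iff_imp]
      rintro rfl
      exact Finset.mem_powerset.1 (Finset.mem_of_mem_erase hT)
  induction S using Finset.strongInduction with
  | H S ih =>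
    have h := R.card_support_subset R' i S
    rw [key R, key R', Finset.sum_congr rfl fun T hT => ih T (Finset.mem_ssubsets.1 hT)] at h
    exact Nat.add_right_cancel h

lemma exists_support_eq (i : ℕ) (k : Fin (R.rank i)) :
    ∃ k', (R'.degree i k').support = (R.degree i k).support := by
  have h := R.card_support_eq R' i (R.degree i k).support
  have h1 : Nonempty {k' // (R.degree i k').support = (R.degree i k).support} := ⟨⟨k, rfl⟩⟩
  have h2 := Nat.card_pos (α := {k' // (R.degree i k').support = (R.degree i k).support})
  rw [h] at h2
  obtain ⟨⟨k', hk'⟩⟩ := (Nat.card_pos_iff.1 h2).1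
  exact ⟨k', hk'⟩

end Uniqueness

/-- Two hypergraphs that share an induced subhypergraph `G` have resolutions with the same degrees
of basis vectors over the vertices of `G`. -/
lemma exists_degree_eq {K : Type v} [Field K] {V W U : Type u} {H : SpernerHypergraph V}
    {H' : SpernerHypergraph W} {G : SpernerHypergraph U} (f : U ↪ V) (f' : U ↪ W)
    (hf : ∀ e : Finset U, e.map f ∈ H.edges ↔ e ∈ G.edges)
    (hf' : ∀ e : Finset U, e.map f' ∈ H'.edges ↔ e ∈ G.edges)
    (R : MinimalMultigradedResolution (H.edgeIdeal K))
    (R' : MinimalMultigradedResolution (H'.edgeIdeal K)) (i : ℕ) (k : Fin (R.rank i))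
    (hk : ((R.degree i k).support : Set V) ⊆ Set.range f) :
    ∃ k', (R'.degree i k').degree = (R.degree i k).degree := by
  have hdeg : ∀ {X : Type u} (g : U ↪ X) (a : X →₀ ℕ), (a.support : Set X) ⊆ Set.range g →
      (a.comapDomain g g.injective.injOn).degree = a.degree := by
    intro X g a ha
    conv_rhs => rw [← Finsupp.mapDomain_comapDomain g g.injective a ha]
    rw [Finsupp.degree_mapDomain]
  let S := R.restrict f.injective _ (H.map_killCompl_edgeIdeal K G f hf)
  let S' := R'.restrict f'.injective _ (H'.map_killCompl_edgeIdeal K G f' hf')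
  obtain ⟨l, hl⟩ := (subIdx (R.Over f i)).surjective ⟨k, hk⟩
  obtain rfl : (subIdx (R.Over f i) l).1 = k := by rw [hl]
  obtain ⟨l', hl'⟩ := S.exists_support_eq S' i l
  refine ⟨(subIdx (R'.Over f' i) l').1, ?_⟩
  -- Both restrictions resolve the edge ideal of `G`, so their degrees are squarefree and equal
  -- supports give equal total degrees.
  have h1 : (S'.degree i l').degree = (S.degree i l).degree :=
    (S'.degree_degree i l').trans ((congrArg Finset.card hl').trans (S.degree_degree i l).symm)
  exact (hdeg f' _ (subIdx (R'.Over f' i) l').2).symm.trans (h1.trans (hdeg f _ hk))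

end MinimalMultigradedResolution

lemma gradedBetti_ne_zero_iff {σ : Type u} {K : Type v} [Field K] {I : Ideal (MvPolynomial σ K)}
    (h : Nonempty (MinimalMultigradedResolution I)) (i j : ℕ) :
    gradedBetti I i j ≠ 0 ↔ ∃ k, (h.some.degree i k).degree = j := by
  rw [gradedBetti, dif_pos h, Nat.card_ne_zero]
  simp only [nonempty_subtype, Subtype.finite, and_true]

namespace SpernerHypergraph

variable (K : Type v) [Field K] {V W : Type u} [Finite V] [Finite W] {H : SpernerHypergraph V}
  {H' : SpernerHypergraph W}

/-- Graded Betti numbers that do not vanish are detected by the vertex-deleted subhypergraphs and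
the graded Betti numbers in top degree. -/
lemma gradedBetti_ne_zero_of_cards (htop : ∀ i, gradedBetti (H.edgeIdeal K) i (Nat.card V) ≠ 0 →
      gradedBetti (H'.edgeIdeal K) i (Nat.card V) ≠ 0)
    (hcards : ∀ v, ∃ (U : Type u) (G : SpernerHypergraph U) (f : U ↪ V) (f' : U ↪ W),
      (∀ e : Finset U, e.map f ∈ H.edges ↔ e ∈ G.edges) ∧
      (∀ e : Finset U, e.map f' ∈ H'.edges ↔ e ∈ G.edges) ∧ ∀ x, x ≠ v → x ∈ Set.range f)
    {i j : ℕ} (hij : gradedBetti (H.edgeIdeal K) i j ≠ 0) :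
    gradedBetti (H'.edgeIdeal K) i j ≠ 0 := by
  by_cases hj : j = Nat.card V
  · subst hj
    exact htop i hij
  rw [gradedBetti_ne_zero_iff (H.nonempty_resolution K)] at hij
  rw [gradedBetti_ne_zero_iff (H'.nonempty_resolution K)]
  generalize (H.nonempty_resolution K).some = R at hij
  generalize (H'.nonempty_resolution K).some = R'
  obtain ⟨k, rfl⟩ := hij
  -- A squarefree degree with full support would have total degree `Nat.card V`.
  obtain ⟨v, hv⟩ : ∃ v, v ∉ (R.degree i k).support := by
    by_contra! h
    have := Fintype.ofFinite V
    rw [R.degree_degree, Finset.eq_univ_iff_forall.2 h, Nat.card_eq_fintype_card] at hj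
    exact hj rfl
  obtain ⟨U, G, f, f', hf, hf', hrange⟩ := hcards v
  exact MinimalMultigradedResolution.exists_degree_eq f f' hf hf' R R' i k fun x hx =>
    hrange x fun hxv => hv (hxv ▸ hx)

lemma SameDeck.gradedBetti_ne_zero_iff (hdeck : H.SameDeck H')
    (htop : ∀ i, gradedBetti (H'.edgeIdeal K) i (Nat.card W) =
      gradedBetti (H.edgeIdeal K) i (Nat.card V)) (i j : ℕ) :
    gradedBetti (H'.edgeIdeal K) i j ≠ 0 ↔ gradedBetti (H.edgeIdeal K) i j ≠ 0 := by
  obtain ⟨φ, hφ⟩ := hdeck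
  have hcard : Nat.card V = Nat.card W := Nat.card_congr φ
  have hcards : ∀ v, ∃ (f : {x // x ≠ v} ↪ V) (f' : {x // x ≠ v} ↪ W),
      (∀ e, e.map f ∈ H.edges ↔ e ∈ (H.delete v).edges) ∧
      (∀ e, e.map f' ∈ H'.edges ↔ e ∈ (H.delete v).edges) ∧
      (∀ x, x ≠ v → x ∈ Set.range f) ∧ ∀ x, x ≠ φ v → x ∈ Set.range f' := by
    intro v
    obtain ⟨θ, hθ⟩ := hφ v
    refine ⟨Function.Embedding.subtype _, θ.toEmbedding.trans (Function.Embedding.subtype _),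
      fun e => Iff.rfl, fun e => ?_, fun x hx => ⟨⟨x, hx⟩, rfl⟩,
      fun x hx => ⟨θ.symm ⟨x, hx⟩, by simp⟩⟩
    rw [← hθ e, ← Finset.map_map]
    rfl
  constructor
  · refine gradedBetti_ne_zero_of_cards K (fun i h => ?_) fun w => ?_
    · rw [htop, hcard] at h
      exact h
    obtain ⟨f, f', h1, h2, -, h4⟩ := hcards (φ.symm w)
    exact ⟨_, _, f', f, h2, h1, by simpa using h4⟩
  · refine gradedBetti_ne_zero_of_cards K (fun i h => by rwa [hcard, htop]) fun v => ?_
    obtain ⟨f, f', h1, h2, h3, -⟩ := hcards v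
    exact ⟨_, _, f, f', h1, h2, h3⟩

end SpernerHypergraph

namespace MinimalMultigradedResolution

variable {K : Type v} [Field K] {σ : Type u} {I : Ideal (MvPolynomial σ K)}

lemma rank_ne_zero_iff (h : Nonempty (MinimalMultigradedResolution I)) (i : ℕ) :
    h.some.rank i ≠ 0 ↔ ∃ j, gradedBetti I i j ≠ 0 := by
  simp only [gradedBetti_ne_zero_iff h]
  constructor
  · intro h0
    exact ⟨_, ⟨0, Nat.pos_of_ne_zero h0⟩, rfl⟩
  · rintro ⟨j, k, -⟩ h0
    exact (Fin.cast h0 k).elim0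

end MinimalMultigradedResolution

/-- Not even the empty sequence is regular on the zero module, so the supremum is over the empty
set. -/
lemma idealDepth_bot {σ : Type u} {K : Type v} [Field K] :
    idealDepth (⊥ : Ideal (MvPolynomial σ K)) = 0 := by
  rw [idealDepth, sSup_eq_bot.2 ?_, bot_eq_zero']
  rintro _ ⟨rs, -, hreg, -⟩
  exact absurd (Subsingleton.elim _ _) hreg.2

end

theorem proposition4p9 (K : Type v) [Field K] {V : Type u} [Finite V]
    (hn : 3 ≤ Nat.card V) (H : SpernerHypergraph V)
    (hBetti : ∀ i : ℕ, SpernerHypergraph.Reconstructible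
      (fun (W : Type u) (G : SpernerHypergraph W) => gradedBetti (G.edgeIdeal K) i (Nat.card W)) H) :
    SpernerHypergraph.Reconstructible
      (fun (W : Type u) (G : SpernerHypergraph W) => idealDepth (G.edgeIdeal K)) H ∧
    SpernerHypergraph.Reconstructible
      (fun (W : Type u) (G : SpernerHypergraph W) => idealProjDim (G.edgeIdeal K)) H ∧
    SpernerHypergraph.Reconstructible
      (fun (W : Type u) (G : SpernerHypergraph W) => idealRegularity (G.edgeIdeal K)) H := by
  have main : ∀ (W : Type u) (H' : SpernerHypergraph W), H.SameDeck H' →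
      idealDepth (H'.edgeIdeal K) = idealDepth (H.edgeIdeal K) ∧
      idealProjDim (H'.edgeIdeal K) = idealProjDim (H.edgeIdeal K) ∧
      idealRegularity (H'.edgeIdeal K) = idealRegularity (H.edgeIdeal K) := by
    intro W H' hdeck
    obtain ⟨φ, -⟩ := id hdeck
    have : Finite W := Finite.of_equiv V φ
    have hcard : Nat.card W = Nat.card V := Nat.card_congr φ.symm
    have hb := hdeck.gradedBetti_ne_zero_iff K fun i => hBetti i H' hdeck
    have hrank : ∀ i, (H'.nonempty_resolution K).some.rank i = 0 ↔
        (H.nonempty_resolution K).some.rank i = 0 := fun i => by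
      rw [← not_iff_not]
      change _ ≠ 0 ↔ _ ≠ 0
      simp only [MinimalMultigradedResolution.rank_ne_zero_iff, hb]
    generalize (H.nonempty_resolution K).some = R at hrank
    generalize (H'.nonempty_resolution K).some = R' at hrank
    refine ⟨?_, ?_, ?_⟩
    · by_cases h0 : R.rank 0 = 0
      · rw [R.ideal_eq_bot_iff.2 h0, R'.ideal_eq_bot_iff.2 ((hrank 0).2 h0), idealDepth_bot,
          idealDepth_bot]
      · classical
        -- The last nonzero index of the resolution; searching up to `Nat.card V` suffices by
        -- `rank_eq_zero`.
        let p := Nat.findGreatest (fun i => R.rank i ≠ 0) (Nat.card V)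
        have hp : R.rank p ≠ 0 := Nat.findGreatest_spec (P := fun i => R.rank i ≠ 0)
          (Nat.zero_le _) h0
        have hpn : p ≤ Nat.card V := Nat.findGreatest_le _
        have hp' : R.rank (p + 1) = 0 := by
          by_cases hpV : p + 1 ≤ Nat.card V
          · exact not_not.1 (Nat.findGreatest_is_greatest (Nat.lt_succ_self p) hpV)
          · exact R.rank_eq_zero (by omega)
        rw [R.idealDepth_eq hp hp' hpn (R.ideal_eq_bot_iff.not.2 h0),
          R'.idealDepth_eq ((hrank p).not.2 hp) ((hrank _).2 hp') (hcard ▸ hpn)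
            (R'.ideal_eq_bot_iff.not.2 ((hrank 0).not.2 h0)), hcard]
    · simp only [idealProjDim, CategoryTheory.projectiveDimension,
        R.hasProjectiveDimensionLT_iff, R'.hasProjectiveDimensionLT_iff, hrank]
    · simp only [idealRegularity, hb]
  exact ⟨fun W H' h => (main W H' h).1, fun W H' h => (main W H' h).2.1,
    fun W H' h => (main W H' h).2.2⟩
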